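/- Let $d\ge 3$. A configuration is a locally finite set $\mathsf X\subset\mathbb R^d$ (finitely many points in each bounded Borel set); $\mathsf X(B)$ is the number of points of $\mathsf X$ in $B$. The space of configurations carries the $\sigma$-algebra generated by the maps $\mathsf X\mapsto \mathsf X(B)$, $B$ bounded Borel, and a (simple) point process is a random element of this space. For $x\in\mathbb R^d$ put $$F_{\mathsf X}(x)=\lim_{R\to\infty}\ \sum_{z\in \mathsf X\setminus\{x\},\ \|x-z\|_2\le R}\frac{x-z}{\|x-z\|_2^{d}}$$ when the limit exists; $\mathsf X$ is called valid if it exists for every $x\in\mathbb R^d$. For $\varepsilon\in\mathbb R$ and $\mathsf X$ valid let $\Pi_\varepsilon\mathsf X=\{x+\varepsilon F_{\mathsf X}(x): x\in \mathsf X\}$. Let $\mathcal P\subset\mathbb R^d$ be a homogeneous Poisson point process of intensity $\rho>0$, and let $\varepsilon\in\mathbb R$. Then, almost surely, $\mathcal P$ is valid, and for any two distinct points $x,y\in\mathcal P$ $$x+\varepsilon F_{\mathcal P}(x)\neq y+\varepsilon F_{\mathcal P}(y).$$ Moreover, $\Pi_\varepsilon\mathcal P$ is (almost surely a configuration, and defines)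 a stationary and isotropic point process of intensity $\rho$: its law is invariant under translations and under rotations about the origin, and $\mathbb E[(\Pi_\varepsilon\mathcal P)(B)]=\rho|B|$ for every Borel set $B\subset\mathbb R^d$, where $|B|$ is the Lebesgue measure of $B$. -/

import Mathlib

open MeasureTheory ProbabilityTheory Filter Topology
open scoped NNReal ENNReal

namespace RepelledPoisson

/-- A set of points of `ℝ^d` is locally finite if it has finitely many points in every bounded
Borel set. -/
def IsLocallyFinite {d : ℕ} (X : Set (EuclideanSpace ℝ (Fin d))) : Prop :=
  ∀ B : Set (EuclideanSpace ℝ (Fin d)), MeasurableSet B → Bornology.IsBounded B → (X ∩ B).Finite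

/-- Configurations: locally finite subsets of `ℝ^d`. -/
structure Configuration (d : ℕ) where
  /-- the underlying set of points -/
  carrier : Set (EuclideanSpace ℝ (Fin d))
  locallyFinite : IsLocallyFinite carrier

namespace Configuration

variable {d : ℕ}

instance : SetLike (Configuration d) (EuclideanSpace ℝ (Fin d)) where
  coe := carrier
  coe_injective X Y h := by cases X; cases Y; congr

/-- The number of points of the configuration in `B`. -/
noncomputable def count (X : Configuration d) (B : Set (EuclideanSpace ℝ (Fin d))) : ℕ∞ :=
  ((X : Set (EuclideanSpace ℝ (Fin d))) ∩ B).encard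

/-- The `σ`-algebra generated by the maps `X ↦ X(B)`, for `B` a bounded Borel set. -/
noncomputable instance : MeasurableSpace (Configuration d) :=
  ⨆ (B : Set (EuclideanSpace ℝ (Fin d))) (_ : MeasurableSet B) (_ : Bornology.IsBounded B),
    MeasurableSpace.comap (fun X : Configuration d => X.count B) inferInstance

/-- The image of a configuration by an isometry of `ℝ^d`. -/
noncomputable def image (e : EuclideanSpace ℝ (Fin d) ≃ᵢ EuclideanSpace ℝ (Fin d)) (X : Configuration d) :
    Configuration d where
  carrier := e '' X
  locallyFinite B hB hb := by
    have h := (X.locallyFinite (e ⁻¹' B) (e.continuous.measurable hB)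
      (e.isometry.antilipschitz.isBounded_preimage hb)).image e
    refine h.subset ?_
    rintro _ ⟨⟨x, hx, rfl⟩, hxB⟩
    exact ⟨x, ⟨hx, hxB⟩, rfl⟩

/-- The translated configuration `X + y = {x + y : x ∈ X}`. -/
noncomputable def translate (y : EuclideanSpace ℝ (Fin d)) (X : Configuration d) : Configuration d :=
  X.image (IsometryEquiv.addRight y)

/-- The empty configuration. -/
def empty : Configuration d where
  carrier := ∅
  locallyFinite B _ _ := by simp

end Configuration

/-- The sum of `(x - z) / ‖x - z‖^d` over the (finitely many) points `z ≠ x` of `X` in the ball of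
radius `R` around `x`. -/
noncomputable def partialForce {d : ℕ} (X : Configuration d) (x : EuclideanSpace ℝ (Fin d))
    (R : ℝ) : EuclideanSpace ℝ (Fin d) :=
  ∑ᶠ z ∈ ((X : Set (EuclideanSpace ℝ (Fin d))) \ {x}) ∩ Metric.closedBall x R,
    (‖x - z‖ ^ d)⁻¹ • (x - z)

/-- The Coulomb force `F_X(x)`: the limit of the sums over increasing balls centred at `x`
(only meaningful when that limit exists). -/
noncomputable def force {d : ℕ} (X : Configuration d) (x : EuclideanSpace ℝ (Fin d)) :
    EuclideanSpace ℝ (Fin d) :=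
  limUnder atTop (partialForce X x)

/-- A configuration is valid if the limit defining `F_X(x)` exists for all `x ∈ ℝ^d`. -/
def IsValid {d : ℕ} (X : Configuration d) : Prop :=
  ∀ x : EuclideanSpace ℝ (Fin d), ∃ f, Tendsto (partialForce X x) atTop (𝓝 f)

/-- The set `{x + ε F_X(x) : x ∈ X}`. -/
noncomputable def repelledSet {d : ℕ} (ε : ℝ) (X : Configuration d) :
    Set (EuclideanSpace ℝ (Fin d)) :=
  (fun x => x + ε • force X x) '' X

open Classical in
/-- The repulsion operator `Π_ε`, `X ↦ {x + ε F_X(x) : x ∈ X}`, on the valid configurations for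
which this set is again a configuration; all other configurations are sent to the empty one. -/
noncomputable def repulsion {d : ℕ} (ε : ℝ) (X : Configuration d) : Configuration d :=
  if h : IsValid X ∧ IsLocallyFinite (repelledSet ε X) then ⟨repelledSet ε X, h.2⟩
  else Configuration.empty

section PointProcess

variable {d : ℕ} {Ω : Type*} [MeasurableSpace Ω]

/-- A (simple) point process: a random element of the space of configurations
(random elements are, as usual, considered up to almost sure equality). -/
def IsPointProcess (X : Ω → Configuration d) (μ : Measure Ω) : Prop :=
  AEMeasurable X μ

/-- Stationarity: the law of the process is invariant by translation. -/
def IsStationary (X : Ω → Configuration d) (μ : Measure Ω) : Prop :=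
  ∀ y : EuclideanSpace ℝ (Fin d), IdentDistrib (fun ω => (X ω).translate y) X μ μ

/-- Isotropy: the law of the process is invariant by rotation, i.e. by the linear isometries of
determinant `1`. -/
def IsIsotropic (X : Ω → Configuration d) (μ : Measure Ω) : Prop :=
  ∀ r : EuclideanSpace ℝ (Fin d) ≃ₗᵢ[ℝ] EuclideanSpace ℝ (Fin d),
    LinearMap.det (r.toLinearEquiv : EuclideanSpace ℝ (Fin d) →ₗ[ℝ] EuclideanSpace ℝ (Fin d)) = 1 →
      IdentDistrib (fun ω => (X ω).image r.toIsometryEquiv) X μ μ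

/-- The process has (constant) intensity `ρ`: its first intensity measure `B ↦ 𝔼[X(B)]` is
`ρ` times the Lebesgue measure. -/
def HasIntensity (X : Ω → Configuration d) (μ : Measure Ω) (ρ : ℝ≥0) : Prop :=
  ∀ B : Set (EuclideanSpace ℝ (Fin d)), MeasurableSet B →
    ∫⁻ ω, ((X ω).count B : ℝ≥0∞) ∂μ = ρ * volume B

/-- `X` is a homogeneous Poisson point process of intensity `ρ`. -/
structure IsHomogeneousPoisson (X : Ω → Configuration d) (μ : Measure Ω) (ρ : ℝ≥0) : Prop where
  isPointProcess : IsPointProcess X μ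
  /-- The number of points in a bounded Borel set `B` has Poisson law of mean `ρ |B|`. -/
  law_count : ∀ B : Set (EuclideanSpace ℝ (Fin d)), MeasurableSet B → Bornology.IsBounded B →
    μ.map (fun ω => (X ω).count B) =
      (poissonMeasure (ρ * (volume B).toNNReal)).map (Nat.cast : ℕ → ℕ∞)
  /-- The numbers of points in pairwise disjoint Borel sets are independent. -/
  indep_count : ∀ (n : ℕ) (B : Fin n → Set (EuclideanSpace ℝ (Fin d))),
    (∀ i, MeasurableSet (B i)) → Pairwise (fun i j => Disjoint (B i) (B j)) →
      iIndepFun (fun i ω => (X ω).count (B i)) μ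

end PointProcess

end RepelledPoisson

/-! ### Configurations as counting measures: measurability, adding a point, restricting -/

namespace RepelledPoisson

open Set Metric

namespace Configuration

variable {d : ℕ}

/-! The main tool is the Mecke formula `mecke`: the mean of `∑_{z ∈ X} G(X, z)` equals `ρ` times the
mean of `∫ G(X ∪ {z}, z) dz`. It comes from the recursion `(n + 1) p(n + 1) = r p(n)` for Poisson
weights and from the independence of counts in disjoint sets. All arguments take place on the space
of configurations, under the law `L` of the process.

Validity. For a bounded square-integrable `g`, the sums of `g` over the points in increasing bounded
sets, minus their means, form a martingale bounded in L², so they converge almost surely. Away from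
its singularity the Coulomb kernel decays like `‖u‖^(-(d-1))`, which is square-integrable at
infinity because `2(d-1) > d`. This yields convergence almost surely for countably many functions,
centres `c` and meshes `h`, along the balls of radius `n h` around `c`. The passage to every `x` and
to all real radii is deterministic (`isValid_of_convergesAlong`). For `x` near `c`, the kernel based
at `x` is an affine combination of those based at `c` and `c + e_i`, up to an absolutely summable
error of order `‖u‖^(-(d+1))`. A ball around `x` lies between two balls around `c` whose radii
differ by `3h`. The shell between them has weight `O(h)`, both in mean and, eventually, for the
configuration itself. The mean force over a ball centred at `x` vanishes by oddness, so no
compensation remains. The partial forces thus oscillate by `O(h)` at most, with `h` arbitrarily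
small.

No collisions. Two applications of Mecke reduce a collision of two points of the process to a
collision of two fixed points `x ≠ y` added to it, that is, to the event that `F(x) - F(y)` equals a
given vector. A third application resamples one more point `z`: the level sets of `z ↦ coulomb (x -
z) - coulomb (y - z)` are Lebesgue-null when `d ≥ 3` (`volume_coulomb_sub_eq_zero`), and the process
almost surely has a point.

Law of the image. The repulsion commutes with isometries and the Poisson law is invariant under
them, whence stationarity and isotropy. For the intensity, a point exerts no force on itself, so
Mecke gives `ρ 𝔼 ∫ 1_B(x + ε F(x)) dx`. By stationarity `F(x)` may be replaced by `F(0)`, and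
translation invariance of the Lebesgue measure leaves `ρ |B|`. The same computation shows that the
image is locally finite. -/

theorem finite_inter_of_isBounded (X : Configuration d) {B : Set (EuclideanSpace ℝ (Fin d))}
    (hB : Bornology.IsBounded B) : ((X : Set (EuclideanSpace ℝ (Fin d))) ∩ B).Finite := by
  obtain ⟨r, hr⟩ := hB.subset_closedBall 0
  exact (X.locallyFinite (closedBall 0 r) measurableSet_closedBall isBounded_closedBall).subset
    (inter_subset_inter_right _ hr)

theorem countable (X : Configuration d) : (X : Set (EuclideanSpace ℝ (Fin d))).Countable := by
  have : (X : Set (EuclideanSpace ℝ (Fin d))) = ⋃ n : ℕ, (X : Set _) ∩ closedBall 0 n := by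
    rw [← inter_iUnion, iUnion_closedBall_nat, inter_univ]
  rw [this]
  exact countable_iUnion fun n => (X.finite_inter_of_isBounded isBounded_closedBall).countable

theorem measurableSet_coe (X : Configuration d) :
    MeasurableSet (X : Set (EuclideanSpace ℝ (Fin d))) :=
  X.countable.measurableSet

/-- The counting measure of a configuration. -/
noncomputable def countMeasure (X : Configuration d) : Measure (EuclideanSpace ℝ (Fin d)) :=
  Measure.count.restrict X

theorem countMeasure_apply (X : Configuration d) {B : Set (EuclideanSpace ℝ (Fin d))}
    (hB : MeasurableSet B) : X.countMeasure B = X.count B := by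
  rw [countMeasure, Measure.restrict_apply hB, Measure.count_apply (hB.inter X.measurableSet_coe),
    count, inter_comm]

theorem count_lt_top (X : Configuration d) {B : Set (EuclideanSpace ℝ (Fin d))}
    (hB : Bornology.IsBounded B) : X.count B < ⊤ :=
  Set.encard_lt_top_iff.2 (X.finite_inter_of_isBounded hB)

theorem countMeasure_lt_top (X : Configuration d) {B : Set (EuclideanSpace ℝ (Fin d))}
    (hB : Bornology.IsBounded B) : X.countMeasure B < ∞ := by
  obtain ⟨r, hr⟩ := hB.subset_closedBall 0
  refine (measure_mono hr).trans_lt ?_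
  rw [countMeasure_apply _ measurableSet_closedBall]
  have := X.count_lt_top (B := closedBall 0 r) isBounded_closedBall
  exact ENat.toENNReal_lt_top.2 this

theorem measurable_count {B : Set (EuclideanSpace ℝ (Fin d))} (hB : MeasurableSet B)
    (hb : Bornology.IsBounded B) : Measurable fun X : Configuration d => X.count B := by
  rw [measurable_iff_comap_le]
  exact le_iSup_of_le B (le_iSup_of_le hB (le_iSup_of_le hb le_rfl))

theorem measurable_countMeasure_apply {B : Set (EuclideanSpace ℝ (Fin d))}
    (hB : MeasurableSet B) : Measurable fun X : Configuration d => X.countMeasure B := by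
  have h (X : Configuration d) : X.countMeasure B =
      ⨆ n : ℕ, (X.count (B ∩ closedBall 0 n) : ℝ≥0∞) := by
    have hm : Monotone fun n : ℕ => B ∩ closedBall (0 : EuclideanSpace ℝ (Fin d)) n :=
      fun m n hmn => inter_subset_inter_right _ (closedBall_subset_closedBall (by exact_mod_cast hmn))
    have hU : B = ⋃ n : ℕ, B ∩ closedBall 0 n := by
      rw [← inter_iUnion, iUnion_closedBall_nat, inter_univ]
    conv_lhs => rw [hU]
    rw [hm.measure_iUnion]
    simp_rw [fun n : ℕ => X.countMeasure_apply (hB.inter (measurableSet_closedBall (x := 0) (ε := n)))]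
  simp_rw [h]
  exact Measurable.iSup fun n => Measurable.of_discrete.comp
    (measurable_count (hB.inter measurableSet_closedBall)
      (isBounded_closedBall.subset inter_subset_right))

theorem measurable_count_of_measurableSet {B : Set (EuclideanSpace ℝ (Fin d))}
    (hB : MeasurableSet B) : Measurable fun X : Configuration d => X.count B := by
  rw [ENat.measurable_iff]
  intro n
  have : (fun X : Configuration d => X.count B) ⁻¹' {(n : ℕ∞)} =
      (fun X : Configuration d => X.countMeasure B) ⁻¹' {(n : ℝ≥0∞)} := by
    ext X
    simp only [mem_preimage, mem_singleton_iff, countMeasure_apply _ hB]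
    rw [← ENat.toENNReal_coe, ENat.toENNReal_inj]
  rw [this]
  exact measurable_countMeasure_apply hB (measurableSet_singleton _)

/-- A map into the space of configurations is measurable as soon as the numbers of points in
bounded Borel sets are. -/
theorem measurable_of_countMeasure {α : Type*} [MeasurableSpace α] {f : α → Configuration d}
    (h : ∀ B, MeasurableSet B → Bornology.IsBounded B →
      Measurable fun a => (f a).countMeasure B) : Measurable f := by
  refine Measurable.of_comap_le ?_
  simp_rw [instMeasurableSpace, MeasurableSpace.comap_iSup, MeasurableSpace.comap_comp]
  refine iSup_le fun B => iSup_le fun hB => iSup_le fun hb => ?_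
  rw [← measurable_iff_comap_le, ENat.measurable_iff]
  intro n
  have : ((fun X : Configuration d => X.count B) ∘ f) ⁻¹' {(n : ℕ∞)} =
      (fun a => (f a).countMeasure B) ⁻¹' {(n : ℝ≥0∞)} := by
    ext a
    simp only [mem_preimage, Function.comp, mem_singleton_iff, countMeasure_apply _ hB]
    rw [← ENat.toENNReal_coe, ENat.toENNReal_inj]
  rw [this]
  exact h B hB hb (measurableSet_singleton _)

end Configuration

/-- A kernel which gives finite mass to the cells of a countable measurable partition
is s-finite. -/
theorem isSFiniteKernel_of_partition {α β : Type*} [MeasurableSpace α] [MeasurableSpace β]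
    (κ : Kernel α β) (A : ℕ → Set β) (hA : ∀ n, MeasurableSet (A n))
    (hd : Pairwise (Function.onFun Disjoint A)) (hU : ⋃ n, A n = univ)
    (hfin : ∀ a n, κ a (A n) < ∞) : IsSFiniteKernel κ := by
  classical
  have hS (n k : ℕ) : MeasurableSet {a | ⌊(κ a (A n)).toReal⌋₊ = k} :=
    (Nat.measurable_floor.comp (κ.measurable_coe (hA n)).ennreal_toReal) (measurableSet_singleton k)
  -- The piece with index `(n, k)` keeps the mass of the cell `A n` on the event that its integer
  -- part is `k`; its total mass is thus at most `k + 1`, uniformly in the parameter.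
  let η (p : ℕ × ℕ) : Kernel α β := Kernel.piecewise (hS p.1 p.2) (κ.restrict (hA p.1)) 0
  have hη (p) : IsFiniteKernel (η p) := by
    refine ⟨⟨(p.2 : ℝ≥0∞) + 1, by finiteness, fun a => ?_⟩⟩
    rw [Kernel.piecewise_apply]
    split_ifs with h
    · rw [Kernel.restrict_apply, Measure.restrict_apply_univ]
      rw [← ENNReal.ofReal_toReal (hfin a p.1).ne]
      have := (Nat.lt_floor_add_one (κ a (A p.1)).toReal).le
      rw [mem_ofPred_eq] at h
      rw [h] at this
      refine (ENNReal.ofReal_le_ofReal this).trans ?_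
      rw [ENNReal.ofReal_add (by positivity) zero_le_one]
      simp
    · simp
  have : κ = Kernel.sum η := by
    ext a s hs
    rw [Kernel.sum_apply' _ _ hs, ENNReal.tsum_prod (f := fun n k => η (n, k) a s)]
    have h1 (n : ℕ) : ∑' k, η (n, k) a s = κ a (s ∩ A n) := by
      rw [tsum_eq_single ⌊(κ a (A n)).toReal⌋₊]
      · simp [η, Kernel.piecewise_apply, Kernel.restrict_apply, Measure.restrict_apply hs]
      · intro k hk
        simp [η, Kernel.piecewise_apply, hk.symm]
    simp_rw [h1]
    rw [← measure_iUnion]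
    · rw [← inter_iUnion, hU, inter_univ]
    · exact fun i j hij => (hd hij).mono inter_subset_right inter_subset_right
    · exact fun n => hs.inter (hA n)
  rw [this]
  infer_instance

variable {d : ℕ}

/-- The kernel which maps a configuration to its counting measure. -/
noncomputable def pointKernel (d : ℕ) : Kernel (Configuration d) (EuclideanSpace ℝ (Fin d)) where
  toFun := Configuration.countMeasure
  measurable' := Measure.measurable_of_measurable_coe _ fun _ hB =>
    Configuration.measurable_countMeasure_apply hB

theorem pointKernel_apply (X : Configuration d) : pointKernel d X = X.countMeasure := rfl

/-- Total masses may be infinite, but the shells between consecutive integer balls have finite mass.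
S-finiteness is what gives access to composition products, Fubini and joint measurability of sums
over the points. -/
instance : IsSFiniteKernel (pointKernel d) := by
  refine isSFiniteKernel_of_partition _ (disjointed fun n : ℕ => closedBall 0 n)
    (fun n => MeasurableSet.disjointed (fun n => measurableSet_closedBall) n) (disjoint_disjointed _)
    (by rw [iUnion_disjointed, iUnion_closedBall_nat]) fun X n => ?_
  exact X.countMeasure_lt_top (isBounded_closedBall.subset (disjointed_subset _ n))

namespace Configuration

instance : Insert (EuclideanSpace ℝ (Fin d)) (Configuration d) where
  insert z X :=
  { carrier := insert z (X : Set (EuclideanSpace ℝ (Fin d)))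
    locallyFinite := fun B _ hb => by
      refine ((X.finite_inter_of_isBounded hb).union (finite_singleton z)).subset ?_
      rintro y ⟨rfl | hy, hyB⟩
      · exact Or.inr rfl
      · exact Or.inl ⟨hy, hyB⟩ }

theorem coe_insert (z : EuclideanSpace ℝ (Fin d)) (X : Configuration d) :
    ((insert z X : Configuration d) : Set (EuclideanSpace ℝ (Fin d))) = insert z (X : Set _) := rfl

theorem countMeasure_insert {z : EuclideanSpace ℝ (Fin d)} {X : Configuration d} (hz : z ∉ X) :
    (insert z X : Configuration d).countMeasure = Measure.dirac z + X.countMeasure := by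
  rw [countMeasure, coe_insert, Set.insert_eq, Measure.restrict_union _ X.measurableSet_coe,
    Measure.restrict_singleton, Measure.count_singleton, one_smul, countMeasure]
  exact disjoint_singleton_left.2 hz

theorem insert_eq_self {z : EuclideanSpace ℝ (Fin d)} {X : Configuration d} (hz : z ∈ X) :
    (insert z X : Configuration d) = X :=
  SetLike.coe_injective (by rw [coe_insert]; exact Set.insert_eq_of_mem hz)

theorem countMeasure_singleton_eq_zero {z : EuclideanSpace ℝ (Fin d)} {X : Configuration d} :
    X.countMeasure {z} = 0 ↔ z ∉ X := by
  rw [countMeasure, Measure.restrict_apply (measurableSet_singleton z),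
    Measure.count_eq_zero_iff, ← Set.disjoint_iff_inter_eq_empty, disjoint_singleton_left]
  rfl

/-- Membership means that the counting measure charges the diagonal section `{z}`, and masses of
sections of a measurable set are jointly measurable for an s-finite kernel. -/
theorem measurableSet_mem : MeasurableSet {p : Configuration d × EuclideanSpace ℝ (Fin d) |
    p.2 ∈ p.1} := by
  have h : Measurable fun p : Configuration d × EuclideanSpace ℝ (Fin d) =>
      pointKernel d p.1 (Prod.mk p ⁻¹' {q : (Configuration d × EuclideanSpace ℝ (Fin d)) ×
        EuclideanSpace ℝ (Fin d) | q.1.2 = q.2}) :=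
    Kernel.measurable_kernel_prodMk_left (κ := (pointKernel d).comap Prod.fst measurable_fst)
      (measurableSet_eq_fun (by fun_prop) (by fun_prop))
  have h2 := (h (measurableSet_singleton 0)).compl
  convert! h2 using 1
  ext ⟨X, z⟩
  simp only [mem_ofPred_eq, mem_compl_iff, mem_preimage, mem_singleton_iff, pointKernel_apply]
  have : (Prod.mk (X, z) ⁻¹' {q : (Configuration d × EuclideanSpace ℝ (Fin d)) ×
        EuclideanSpace ℝ (Fin d) | q.1.2 = q.2}) = {z} := by
    ext y; simp [eq_comm]
  rw [this, countMeasure_singleton_eq_zero, not_not]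

theorem measurable_insert : Measurable fun p : Configuration d × EuclideanSpace ℝ (Fin d) =>
    (insert p.2 p.1 : Configuration d) := by
  classical
  refine measurable_of_countMeasure fun B hB _ => ?_
  have : (fun p : Configuration d × EuclideanSpace ℝ (Fin d) =>
      (insert p.2 p.1 : Configuration d).countMeasure B) = fun p =>
        if p.2 ∈ p.1 then p.1.countMeasure B else B.indicator 1 p.2 + p.1.countMeasure B := by
    ext ⟨X, z⟩
    dsimp only
    split_ifs with h
    · rw [insert_eq_self h]
    · rw [countMeasure_insert h, Measure.add_apply, Measure.dirac_apply' _ hB]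
  rw [this]
  refine Measurable.ite measurableSet_mem ?_ ?_
  · exact (measurable_countMeasure_apply hB).comp measurable_fst
  · exact ((measurable_one.indicator hB).comp measurable_snd).add
      ((measurable_countMeasure_apply hB).comp measurable_fst)

/-- The restriction of a configuration to a set. -/
noncomputable def restrict (X : Configuration d) (A : Set (EuclideanSpace ℝ (Fin d))) :
    Configuration d where
  carrier := X ∩ A
  locallyFinite _ _ hb := (X.finite_inter_of_isBounded hb).subset
    (inter_subset_inter_left _ inter_subset_left)

theorem coe_restrict (X : Configuration d) (A : Set (EuclideanSpace ℝ (Fin d))) :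
    (X.restrict A : Set (EuclideanSpace ℝ (Fin d))) = (X : Set _) ∩ A := rfl

theorem countMeasure_restrict (X : Configuration d) {A : Set (EuclideanSpace ℝ (Fin d))}
    (hA : MeasurableSet A) : (X.restrict A).countMeasure = X.countMeasure.restrict A := by
  rw [countMeasure, coe_restrict, countMeasure, Measure.restrict_restrict hA, inter_comm]

theorem measurable_restrict {A : Set (EuclideanSpace ℝ (Fin d))} (hA : MeasurableSet A) :
    Measurable fun X : Configuration d => X.restrict A := by
  refine measurable_of_countMeasure fun B hB _ => ?_
  simp_rw [countMeasure_restrict _ hA, Measure.restrict_apply hB]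
  exact measurable_countMeasure_apply (hB.inter hA)

/-- The form of spatial independence needed later: through Mecke, it makes sums over points outside
`A` uncorrelated with events that depend on the configuration inside `A`. -/
theorem restrict_insert_of_notMem {z : EuclideanSpace ℝ (Fin d)} (X : Configuration d)
    {A : Set (EuclideanSpace ℝ (Fin d))} (hz : z ∉ A) :
    (insert z X : Configuration d).restrict A = X.restrict A :=
  SetLike.coe_injective (by rw [coe_restrict, coe_insert, insert_inter_of_notMem hz, coe_restrict])

theorem restrict_restrict (X : Configuration d) (A B : Set (EuclideanSpace ℝ (Fin d))) :
    (X.restrict A).restrict B = X.restrict (A ∩ B) :=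
  SetLike.coe_injective (by simp_rw [coe_restrict, inter_assoc])

end Configuration

end RepelledPoisson

/-! ### Uniqueness of measures from counts of disjoint sets -/

namespace RepelledPoisson

open Set Metric

namespace Configuration

variable {d : ℕ}

/-- The atom of the algebra generated by a family of sets, which is inside the sets with index in
`s` and outside of the others. -/
def atom {α ι : Type*} (C : ι → Set α) (s : Set ι) : Set α := {z | ∀ i, z ∈ C i ↔ i ∈ s}

theorem measurableSet_atom {α ι : Type*} [MeasurableSpace α] [Finite ι] {C : ι → Set α}
    (hC : ∀ i, MeasurableSet (C i)) (s : Set ι) : MeasurableSet (atom C s) := by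
  have : atom C s = ⋂ i, {z | z ∈ C i ↔ i ∈ s} := by ext; simp [atom]
  rw [this]
  refine MeasurableSet.iInter fun i => ?_
  by_cases h : i ∈ s
  · simpa [h] using hC i
  · simp only [h, iff_false]
    exact (hC i).compl

theorem atom_subset {α ι : Type*} {C : ι → Set α} {s : Set ι} {i : ι} (hi : i ∈ s) :
    atom C s ⊆ C i := fun _ hz => (hz i).2 hi

theorem disjoint_atom {α ι : Type*} {C : ι → Set α} {s t : Set ι} (h : s ≠ t) :
    Disjoint (atom C s) (atom C t) := by
  rw [Set.disjoint_left]
  intro z hs ht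
  exact h (Set.ext fun i => (hs i).symm.trans (ht i))

theorem eq_iUnion_atom {α ι : Type*} (C : ι → Set α) (i : ι) :
    C i = ⋃ s ∈ {s : {s : Set ι // s.Nonempty} | i ∈ s.1}, atom C s.1 := by
  ext z
  simp only [mem_iUnion, mem_ofPred_eq, exists_prop, Subtype.exists]
  constructor
  · exact fun hz => ⟨{j | z ∈ C j}, ⟨i, hz⟩, hz, fun j => Iff.rfl⟩
  · rintro ⟨s, -, hi, hz⟩
    exact atom_subset hi hz

-- Reduces arbitrary families to disjoint ones, for which Poisson counts are independent.
open Classical in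
theorem count_eq_sum_atom {ι : Type*} [Finite ι] [Fintype {s : Set ι // s.Nonempty}]
    (X : Configuration d) (C : ι → Set (EuclideanSpace ℝ (Fin d))) (i : ι) :
    X.count (C i) = ∑ s : {s : Set ι // s.Nonempty}, if i ∈ s.1 then X.count (atom C s.1) else 0 := by
  have h1 : (X : Set (EuclideanSpace ℝ (Fin d))) ∩ C i = ⋃ s : {s : Set ι // s.Nonempty},
      if i ∈ s.1 then (X : Set _) ∩ atom C s.1 else ∅ := by
    conv_lhs => rw [eq_iUnion_atom C i]
    ext z
    simp only [mem_inter_iff, mem_iUnion, mem_ofPred_eq, exists_prop]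
    constructor
    · rintro ⟨hz, s, hi, hs⟩
      exact ⟨s, by rw [if_pos hi]; exact ⟨hz, hs⟩⟩
    · rintro ⟨s, hs⟩
      split_ifs at hs with hi
      · exact ⟨hs.1, s, hi, hs.2⟩
      · exact hs.elim
  rw [count, h1, Set.encard_iUnion_of_finite, finsum_eq_sum_of_fintype]
  · refine Finset.sum_congr rfl fun s _ => ?_
    split_ifs <;> simp [count]
  · intro s t hst
    have := disjoint_atom (C := C) fun h => hst (Subtype.ext h)
    change Disjoint (ite _ _ _) (ite _ _ _)
    split_ifs
    · exact this.mono inter_subset_right inter_subset_right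
    all_goals simp

/-- The numbers of points in the sets of a family. -/
noncomputable def countVec {ι : Type*} (C : ι → Set (EuclideanSpace ℝ (Fin d)))
    (X : Configuration d) : ι → ℕ∞ := fun i => X.count (C i)

theorem measurable_countVec {ι : Type*} {C : ι → Set (EuclideanSpace ℝ (Fin d))}
    (hC : ∀ i, MeasurableSet (C i)) (hb : ∀ i, Bornology.IsBounded (C i)) :
    Measurable (countVec C) :=
  measurable_pi_iff.2 fun i => measurable_count (hC i) (hb i)

/-- The sets of configurations which are described by finitely many counts. -/
def cylinders (d : ℕ) : Set (Set (Configuration d)) :=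
  {S | ∃ (ι : Type) (_ : Finite ι) (C : ι → Set (EuclideanSpace ℝ (Fin d))) (T : Set (ι → ℕ∞)),
    (∀ i, MeasurableSet (C i)) ∧ (∀ i, Bornology.IsBounded (C i)) ∧ S = countVec C ⁻¹' T}

theorem generateFrom_cylinders :
    (inferInstance : MeasurableSpace (Configuration d)) =
      MeasurableSpace.generateFrom (cylinders d) := by
  refine le_antisymm ?_ ?_
  · refine iSup_le fun B => iSup_le fun hB => iSup_le fun hb => ?_
    rintro _ ⟨T, -, rfl⟩
    refine MeasurableSpace.measurableSet_generateFrom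
      ⟨Unit, inferInstance, fun _ => B, {v | v () ∈ T}, fun _ => hB, fun _ => hb, rfl⟩
  · refine MeasurableSpace.generateFrom_le ?_
    rintro _ ⟨ι, _, C, T, hC, hb, rfl⟩
    exact measurable_countVec hC hb (MeasurableSet.of_discrete)

theorem isPiSystem_cylinders : IsPiSystem (cylinders d) := by
  rintro _ ⟨ι, _, C, T, hC, hb, rfl⟩ _ ⟨ι', _, C', T', hC', hb', rfl⟩ -
  refine ⟨ι ⊕ ι', inferInstance, Sum.elim C C', {v | v ∘ Sum.inl ∈ T ∧ v ∘ Sum.inr ∈ T'},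
    ?_, ?_, rfl⟩
  · rintro (i | i); exacts [hC i, hC' i]
  · rintro (i | i); exacts [hb i, hb' i]

/-- Two finite measures on the space of configurations are equal if they give the same law to
the counts of finitely many disjoint bounded Borel sets, among which those composing a given
set `A`. -/
theorem ext_of_count {m₁ m₂ : Measure (Configuration d)} [IsFiniteMeasure m₁]
    {A : Set (EuclideanSpace ℝ (Fin d))} (hA : MeasurableSet A) (hAb : Bornology.IsBounded A)
    (h : ∀ (ι : Type) [Fintype ι] (B : ι → Set (EuclideanSpace ℝ (Fin d))) (J : Set ι) (k : ι → ℕ),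
      (∀ i, MeasurableSet (B i)) → (∀ i, Bornology.IsBounded (B i)) →
      Pairwise (Function.onFun Disjoint B) → A = ⋃ j ∈ J, B j →
      m₁ {X | ∀ i, X.count (B i) = k i} = m₂ {X | ∀ i, X.count (B i) = k i}) : m₁ = m₂ := by
  classical
  have key : ∀ S ∈ cylinders d, m₁ S = m₂ S := by
    rintro _ ⟨ι, _, C, T, hC, hb, rfl⟩
    -- Adjoining `A` to the family makes it a union of atoms.
    let C' : Option ι → Set (EuclideanSpace ℝ (Fin d)) := fun o => o.elim A C
    have hC' : ∀ o, MeasurableSet (C' o) := by rintro (_ | i); exacts [hA, hC i]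
    have hb' : ∀ o, Bornology.IsBounded (C' o) := by rintro (_ | i); exacts [hAb, hb i]
    -- The atom outside of all the sets is excluded: it is the only one that may be unbounded.
    let κ := {s : Set (Option ι) // s.Nonempty}
    let _ : Fintype κ := Fintype.ofFinite κ
    let B : κ → Set (EuclideanSpace ℝ (Fin d)) := fun s => atom C' s.1
    have hB (s) : MeasurableSet (B s) := measurableSet_atom hC' _
    have hBb (s : κ) : Bornology.IsBounded (B s) := (hb' s.2.some).subset (atom_subset s.2.some_mem)
    have hmap : m₁.map (countVec B) = m₂.map (countVec B) := by
      refine Measure.ext_of_singleton fun k => ?_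
      rw [Measure.map_apply (measurable_countVec hB hBb) (measurableSet_singleton k),
        Measure.map_apply (measurable_countVec hB hBb) (measurableSet_singleton k)]
      by_cases hk : ∀ i, k i ≠ ⊤
      · have hset : countVec B ⁻¹' {k} = {X | ∀ i, X.count (B i) = ((k i).toNat : ℕ∞)} := by
          ext X
          simp only [mem_preimage, mem_singleton_iff, funext_iff, countVec, mem_ofPred_eq]
          simp_rw [ENat.natCast_toNat (hk _)]
        rw [hset]
        refine h κ B {s | none ∈ s.1} _ hB hBb (fun s t hst => ?_) ?_
        · exact disjoint_atom fun h => hst (Subtype.ext h)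
        · exact eq_iUnion_atom C' none
      · push Not at hk
        obtain ⟨i, hi⟩ := hk
        have : countVec B ⁻¹' {k} = ∅ := by
          ext X
          simp only [mem_preimage, mem_singleton_iff, mem_empty_iff_false, iff_false]
          rintro rfl
          exact (X.count_lt_top (hBb i)).ne hi
        simp [this]
    have hpre : countVec C ⁻¹' T = countVec B ⁻¹'
        {v | (fun i => ∑ s : κ, if some i ∈ s.1 then v s else 0) ∈ T} := by
      ext X
      have : countVec C X = fun i => ∑ s : κ, if some i ∈ s.1 then countVec B X s else 0 := by
        funext i
        exact count_eq_sum_atom X C' (some i)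
      simp [this]
    rw [hpre, ← Measure.map_apply (measurable_countVec hB hBb) MeasurableSet.of_discrete,
      ← Measure.map_apply (measurable_countVec hB hBb) MeasurableSet.of_discrete, hmap]
  refine ext_of_generate_finite _ generateFrom_cylinders isPiSystem_cylinders key ?_
  -- The whole space is the cylinder over the empty family, so the total masses agree.
  exact key _ ⟨Empty, inferInstance, fun i => i.elim, univ, fun i => i.elim, fun i => i.elim, rfl⟩

end Configuration

end RepelledPoisson

/-! ### Poisson processes and the Mecke formula -/

namespace RepelledPoisson

open Set Metric

/-- The size-bias identity of the Poisson weights, from which the Mecke formula is built. -/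
theorem poissonMeasure_succ_mul (r : ℝ≥0) (n : ℕ) :
    ((n + 1 : ℕ) : ℝ≥0∞) * poissonMeasure r {n + 1} = r * poissonMeasure r {n} := by
  rw [poissonMeasure_singleton, poissonMeasure_singleton, ← ENNReal.ofReal_natCast,
    ← ENNReal.ofReal_coe_nnreal (p := r), ← ENNReal.ofReal_mul (by positivity),
    ← ENNReal.ofReal_mul (by positivity)]
  congr 1
  rw [Nat.factorial_succ]
  push_cast
  field_simp
  ring

theorem lintegral_id_poissonMeasure (r : ℝ≥0) :
    ∫⁻ n, (n : ℝ≥0∞) ∂(poissonMeasure r) = r := by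
  rw [lintegral_countable', tsum_eq_zero_add' ENNReal.summable]
  simp_rw [poissonMeasure_succ_mul, ENNReal.tsum_mul_left]
  have h : ∑' n, poissonMeasure r {n} = 1 := by
    have := lintegral_countable' (μ := poissonMeasure r) (fun _ : ℕ => (1 : ℝ≥0∞))
    simpa using this.symm
  simp [h]

variable {d : ℕ}

open _root_.RepelledPoisson.Configuration

namespace IsHomogeneousPoisson

variable {L L' : Measure (Configuration d)} {ρ : ℝ≥0}

/-- Transfers the problem to the law of the process, on the space of configurations. -/
theorem map_id {Ω : Type*} [MeasurableSpace Ω] {μ : Measure Ω} {P : Ω → Configuration d}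
    (hP : IsHomogeneousPoisson P μ ρ) : IsHomogeneousPoisson id (μ.map P) ρ where
  isPointProcess := aemeasurable_id
  law_count B hB hb := by
    rw [← hP.law_count B hB hb]
    exact AEMeasurable.map_map_of_aemeasurable (measurable_count hB hb).aemeasurable
      hP.isPointProcess
  indep_count n B hB hd := by
    have h := hP.indep_count n B hB hd
    rw [iIndepFun_iff_measure_inter_preimage_eq_mul] at h ⊢
    intro S T hT
    have hm (i : Fin n) : MeasurableSet ((fun X : Configuration d => (id X).count (B i)) ⁻¹' T i) :=
      measurable_count_of_measurableSet (hB i) MeasurableSet.of_discrete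
    rw [Measure.map_apply_of_aemeasurable hP.isPointProcess (S.measurableSet_biInter fun i _ => hm i)]
    simp_rw [Measure.map_apply_of_aemeasurable hP.isPointProcess (hm _)]
    rw [preimage_iInter₂]
    exact h S hT

theorem measure_count_eq (hL : IsHomogeneousPoisson id L ρ) {ι : Type*} [Fintype ι]
    {B : ι → Set (EuclideanSpace ℝ (Fin d))} (hB : ∀ i, MeasurableSet (B i))
    (hb : ∀ i, Bornology.IsBounded (B i)) (hd : Pairwise (Function.onFun Disjoint B)) (k : ι → ℕ) :
    L {X | ∀ i, X.count (B i) = k i} =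
      ∏ i, poissonMeasure (ρ * (volume (B i)).toNNReal) {k i} := by
  let e := Fintype.equivFin ι
  have h1 := (hL.indep_count _ (B ∘ e.symm) (fun i => hB _)
    (fun i j hij => hd (e.symm.injective.ne hij))).precomp e.injective
  have h2 := h1.measure_inter_preimage_eq_mul Finset.univ (sets := fun i => {(k i : ℕ∞)})
    (fun i _ => MeasurableSet.of_discrete)
  have h3 : {X : Configuration d | ∀ i, X.count (B i) = k i} =
    ⋂ i ∈ Finset.univ, (fun X : Configuration d => (id X).count ((B ∘ e.symm) (e i))) ⁻¹'
      {(k i : ℕ∞)} := by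
    ext X; simp
  rw [h3, h2]
  refine Finset.prod_congr rfl fun i _ => ?_
  have h4 := hL.law_count (B i) (hB i) (hb i)
  have h5 := congrArg (fun m => m {(k i : ℕ∞)}) h4
  simp only [id] at h5
  rw [Measure.map_apply (measurable_count (hB i) (hb i)) MeasurableSet.of_discrete,
    Measure.map_apply .of_discrete MeasurableSet.of_discrete] at h5
  have h6 : (Nat.cast : ℕ → ℕ∞) ⁻¹' {(k i : ℕ∞)} = {k i} := by ext; simp
  rw [h6] at h5
  simpa using h5

/-- The law of a homogeneous Poisson process is determined by its intensity. -/
theorem ext [IsProbabilityMeasure L] (hL : IsHomogeneousPoisson id L ρ)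
    (hL' : IsHomogeneousPoisson id L' ρ) : L = L' := by
  refine ext_of_count MeasurableSet.empty Bornology.isBounded_empty fun ι _ B J k hB hb hd _ => ?_
  rw [hL.measure_count_eq hB hb hd, hL'.measure_count_eq hB hb hd]

theorem lintegral_countMeasure_of_isBounded (hL : IsHomogeneousPoisson id L ρ)
    {B : Set (EuclideanSpace ℝ (Fin d))} (hB : MeasurableSet B) (hb : Bornology.IsBounded B) :
    ∫⁻ X, X.countMeasure B ∂L = ρ * volume B := by
  have h := hL.law_count B hB hb
  have h2 : ∫⁻ X, X.countMeasure B ∂L = ∫⁻ n : ℕ∞, (n : ℝ≥0∞) ∂(L.map fun X => (id X).count B) := by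
    simp only [id]
    rw [lintegral_map (f := fun n : ℕ∞ => (n : ℝ≥0∞)) .of_discrete (measurable_count hB hb)]
    simp_rw [countMeasure_apply _ hB]
  rw [h2, h, lintegral_map .of_discrete .of_discrete]
  simp only [ENat.toENNReal_coe]
  rw [lintegral_id_poissonMeasure, ENNReal.coe_mul, ENNReal.coe_toNNReal hb.measure_lt_top.ne]

end IsHomogeneousPoisson

/-- Adding a point to a configuration. -/
def addPoint (p : Configuration d × EuclideanSpace ℝ (Fin d)) :
    Configuration d × EuclideanSpace ℝ (Fin d) := (insert p.2 p.1, p.2)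

theorem measurable_addPoint : Measurable (addPoint (d := d)) :=
  measurable_insert.prodMk measurable_snd

theorem ae_notMem [NeZero d] (X : Configuration d) :
    ∀ᵐ z ∂(volume : Measure (EuclideanSpace ℝ (Fin d))), z ∉ X := by
  rw [ae_iff]
  simpa using X.countable.measure_zero volume

namespace IsHomogeneousPoisson

variable {L : Measure (Configuration d)} [IsProbabilityMeasure L] {ρ : ℝ≥0}

/-- A new point in `B j` raises the count of `B j` by one and leaves the other counts alone, since
the sets are disjoint. The right side is therefore `ρ |B j|` times the probability of the counts `k`
with `k j` lowered by one, and `poissonMeasure_succ_mul` applied to the factor `j` gives the left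
side. If `k j = 0`, both sides vanish. -/
theorem mecke_cylinder [NeZero d] (hL : IsHomogeneousPoisson id L ρ) {ι : Type*} [Fintype ι]
    {B : ι → Set (EuclideanSpace ℝ (Fin d))} (hB : ∀ i, MeasurableSet (B i))
    (hb : ∀ i, Bornology.IsBounded (B i)) (hd : Pairwise (Function.onFun Disjoint B)) (k : ι → ℕ)
    (j : ι) :
    ∫⁻ X in {X | ∀ i, X.count (B i) = k i}, X.countMeasure (B j) ∂L =
      ∫⁻ X, ρ * volume (B j ∩ {z | ∀ i, (insert z X : Configuration d).count (B i) = k i}) ∂L := by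
  classical
  have hV (k : ι → ℕ) : MeasurableSet {X : Configuration d | ∀ i, X.count (B i) = k i} := by
    have := measurable_countVec hB hb (measurableSet_singleton (fun i => (k i : ℕ∞)))
    convert! this
    ext X; simp [countVec, funext_iff]
  have h1 : ∫⁻ X in {X | ∀ i, X.count (B i) = k i}, X.countMeasure (B j) ∂L =
      k j * L {X | ∀ i, X.count (B i) = k i} := by
    rw [setLIntegral_congr_fun (g := fun _ => (k j : ℝ≥0∞)) (hV k) fun X hX => ?_,
      setLIntegral_const]
    rw [countMeasure_apply _ (hB j), hX j, ENat.toENNReal_coe]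
  rw [h1]
  have hins (X : Configuration d) {z} (hz : z ∉ X) (hzj : z ∈ B j) (i : ι) :
      (insert z X : Configuration d).count (B i) = X.count (B i) + if i = j then 1 else 0 := by
    rw [← ENat.toENNReal_inj, ← countMeasure_apply _ (hB i), countMeasure_insert hz,
      Measure.add_apply, ENat.toENNReal_add, ← countMeasure_apply _ (hB i), add_comm,
      Measure.dirac_apply' _ (hB i)]
    split_ifs with hij
    · subst hij; simp [hzj]
    · have : z ∉ B i := fun h => Set.disjoint_left.1 (hd hij) h hzj
      simp [this]
  have h2 (X : Configuration d) :
      volume (B j ∩ {z | ∀ i, (insert z X : Configuration d).count (B i) = k i}) =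
      {X : Configuration d | ∀ i, X.count (B i) + (if i = j then 1 else 0) = (k i : ℕ∞)}.indicator
        (fun _ => volume (B j)) X := by
    have : (B j ∩ {z | ∀ i, (insert z X : Configuration d).count (B i) = k i} : Set _) =ᵐ[volume]
      (B j ∩ {z | ∀ i, X.count (B i) + (if i = j then 1 else 0) = (k i : ℕ∞)} : Set _) := by
      filter_upwards [ae_notMem X] with z hz
      refine propext (and_congr_right fun hzj => ?_)
      exact forall_congr' fun i => by rw [hins X hz hzj]
    rw [measure_congr this]
    by_cases h : ∀ i, X.count (B i) + (if i = j then 1 else 0) = (k i : ℕ∞)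
    · rw [indicator_of_mem (by exact h)]
      congr 1; ext z; simp [h]
    · rw [indicator_of_notMem (by exact h)]
      convert! measure_empty (μ := volume)
      ext z; simp only [mem_inter_iff, mem_ofPred_eq, h, and_false]; rfl
  simp_rw [h2]
  have hsub : (∃ l, k j = l + 1) ∨ k j = 0 := by
    rcases k j with _ | l
    · exact Or.inr rfl
    · exact Or.inl ⟨l, rfl⟩
  rcases hsub with ⟨l, hl⟩ | hj
  · have hset : {X : Configuration d | ∀ i, X.count (B i) + (if i = j then 1 else 0) = (k i : ℕ∞)} =
        {X | ∀ i, X.count (B i) = ((Function.update k j l i : ℕ) : ℕ∞)} := by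
      ext X
      refine forall_congr' fun i => ?_
      by_cases hij : i = j
      · subst hij
        simp only [if_true, Function.update_self, hl]
        push_cast
        exact ENat.add_left_injective_of_ne_top ENat.one_ne_top |>.eq_iff
      · simp [hij]
    rw [lintegral_const_mul', hset, lintegral_indicator_const (hV _), hL.measure_count_eq hB hb hd,
      hL.measure_count_eq hB hb hd, ← Finset.mul_prod_erase _ _ (Finset.mem_univ j),
      ← Finset.mul_prod_erase _ _ (Finset.mem_univ j), Function.update_self, ← mul_assoc, hl,
      poissonMeasure_succ_mul, ENNReal.coe_mul, ENNReal.coe_toNNReal (hb j).measure_lt_top.ne,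
      mul_assoc, mul_assoc]
    · congr 2
      congr 1
      refine Finset.prod_congr rfl fun i hi => ?_
      rw [Function.update_of_ne (Finset.ne_of_mem_erase hi)]
    · exact ENNReal.coe_ne_top
  · have hset : {X : Configuration d | ∀ i, X.count (B i) + (if i = j then 1 else 0) = (k i : ℕ∞)} = ∅ := by
      ext X
      simp only [mem_ofPred_eq, mem_empty_iff_false, iff_false]
      intro h
      have := h j
      simp [hj] at this
    simp [hset, hj]

/-- Both sides are measures in `S`, and the left one is finite. By `ext_of_count` it suffices to
compare them on count events of a disjoint family in which `A` is a union of members; then sum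
`mecke_cylinder` over these members. -/
theorem mecke_of_isBounded [NeZero d] (hL : IsHomogeneousPoisson id L ρ)
    {A : Set (EuclideanSpace ℝ (Fin d))} (hA : MeasurableSet A) (hb : Bornology.IsBounded A)
    {S : Set (Configuration d)} (hS : MeasurableSet S) :
    ∫⁻ X in S, X.countMeasure A ∂L =
      ∫⁻ X, ρ * volume (A ∩ {z | (insert z X : Configuration d) ∈ S}) ∂L := by
  have hmS {S : Set (Configuration d)} (hS : MeasurableSet S) (X : Configuration d) :
      MeasurableSet {z | (insert z X : Configuration d) ∈ S} :=
    (measurable_insert.comp measurable_prodMk_left) hS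
  let m₁ := L.withDensity fun X => X.countMeasure A
  let m₂ := (L.prod (ρ • (volume : Measure (EuclideanSpace ℝ (Fin d))).restrict A)).map
    fun p => (insert p.2 p.1 : Configuration d)
  have hm₂ {S : Set (Configuration d)} (hS : MeasurableSet S) :
      m₂ S = ∫⁻ X, ρ * volume (A ∩ {z | (insert z X : Configuration d) ∈ S}) ∂L := by
    rw [Measure.map_apply measurable_insert hS, Measure.prod_apply (measurable_insert hS)]
    refine lintegral_congr fun X => ?_
    rw [Measure.smul_apply, Measure.restrict_apply' hA, inter_comm]
    rfl
  have : IsFiniteMeasure m₁ := by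
    refine isFiniteMeasure_withDensity ?_
    rw [hL.lintegral_countMeasure_of_isBounded hA hb]
    exact (ENNReal.mul_lt_top ENNReal.coe_lt_top hb.measure_lt_top).ne
  have hm : m₁ = m₂ := by
    refine ext_of_count hA hb fun ι _ B J k hB hbB hd hAB => ?_
    have hV : MeasurableSet {X : Configuration d | ∀ i, X.count (B i) = k i} := by
      have := measurable_countVec hB hbB (measurableSet_singleton (fun i => (k i : ℕ∞)))
      convert! this
      ext X; simp [countVec, funext_iff]
    classical
    rw [withDensity_apply _ hV, hm₂ hV]
    have hdJ : (J : Set ι).PairwiseDisjoint B := fun i _ j _ hij => hd hij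
    have hAJ : A = ⋃ j ∈ J.toFinset, B j := by simpa using hAB
    have e1 (X : Configuration d) : X.countMeasure A = ∑ j ∈ J.toFinset, X.countMeasure (B j) := by
      rw [hAJ, measure_biUnion_finset (by simpa using hdJ) fun j _ => hB j]
    have e2 (X : Configuration d) : (ρ : ℝ≥0∞) *
          volume (A ∩ {z | (insert z X : Configuration d) ∈ {X | ∀ i, X.count (B i) = (k i : ℕ∞)}}) =
        ∑ j ∈ J.toFinset, ρ * volume (B j ∩
          {z | ∀ i, (insert z X : Configuration d).count (B i) = k i}) := by
      rw [hAJ, iUnion₂_inter, measure_biUnion_finset, Finset.mul_sum]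
      · rfl
      · intro i _ j _ hij
        exact (hd hij).mono inter_subset_left inter_subset_left
      · exact fun j _ => (hB j).inter (hmS hV X)
    simp_rw [e1, e2]
    rw [lintegral_finsetSum _ fun j _ => measurable_countMeasure_apply (hB j),
      lintegral_finsetSum]
    · exact Finset.sum_congr rfl fun j _ => hL.mecke_cylinder hB hbB hd k j
    · intro j _
      refine Measurable.const_mul ?_ _
      have : MeasurableSet {p : Configuration d × EuclideanSpace ℝ (Fin d) | p.2 ∈ B j ∧
          ∀ i, (insert p.2 p.1 : Configuration d).count (B i) = k i} :=
        (measurable_snd (hB j)).inter (measurable_insert hV)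
      exact measurable_measure_prodMk_left this
  rw [← withDensity_apply _ hS, ← hm₂ hS]
  exact congrArg (fun m => m S) hm

/-- The Mecke formula, as an identity between measures. -/
theorem mecke_measure [NeZero d] (hL : IsHomogeneousPoisson id L ρ) :
    L ⊗ₘ pointKernel d = (L.prod (ρ • volume)).map addPoint := by
  have hU : ⋃ n : ℕ, (univ : Set (Configuration d)) ×ˢ
      closedBall (0 : EuclideanSpace ℝ (Fin d)) n = univ := by
    rw [← prod_iUnion, iUnion_closedBall_nat, univ_prod_univ]
  -- Both measures may be infinite, so they are compared after restriction of the point to a ball of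
  -- integer radius, where rectangles determine them.
  rw [← Measure.restrict_univ (μ := L ⊗ₘ pointKernel d),
    ← Measure.restrict_univ (μ := (L.prod _).map _), ← hU, Measure.restrict_iUnion_congr]
  intro n
  have key {s : Set (Configuration d)} {t : Set (EuclideanSpace ℝ (Fin d))} (hs : MeasurableSet s)
      (ht : MeasurableSet t) (hb : Bornology.IsBounded t) : (L ⊗ₘ pointKernel d) (s ×ˢ t) =
      (L.prod (ρ • volume)).map addPoint (s ×ˢ t) := by
    rw [Measure.compProd_apply_prod hs ht, Measure.map_apply measurable_addPoint (hs.prod ht),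
      Measure.prod_apply (measurable_addPoint (hs.prod ht))]
    simp_rw [pointKernel_apply]
    rw [hL.mecke_of_isBounded ht hb hs]
    refine lintegral_congr fun X => ?_
    rw [Measure.smul_apply, inter_comm]
    rfl
  have hfin : IsFiniteMeasure ((L ⊗ₘ pointKernel d).restrict
      (univ ×ˢ closedBall (0 : EuclideanSpace ℝ (Fin d)) n)) := by
    refine ⟨?_⟩
    rw [Measure.restrict_apply_univ, Measure.compProd_apply_prod .univ measurableSet_closedBall,
      Measure.restrict_univ]
    simp_rw [pointKernel_apply]
    rw [hL.lintegral_countMeasure_of_isBounded measurableSet_closedBall isBounded_closedBall]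
    exact ENNReal.mul_lt_top ENNReal.coe_lt_top measure_closedBall_lt_top
  refine Measure.ext_prod fun {s t} hs ht => ?_
  rw [Measure.restrict_apply (hs.prod ht), Measure.restrict_apply (hs.prod ht), prod_inter_prod,
    inter_univ]
  exact key hs (ht.inter measurableSet_closedBall) (isBounded_closedBall.subset inter_subset_right)

theorem mecke [NeZero d] (hL : IsHomogeneousPoisson id L ρ)
    {G : Configuration d → EuclideanSpace ℝ (Fin d) → ℝ≥0∞} (hG : Measurable (Function.uncurry G)) :
    ∫⁻ X, ∫⁻ z, G X z ∂X.countMeasure ∂L = ρ * ∫⁻ X, ∫⁻ z, G (insert z X) z ∂volume ∂L := by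
  have h1 := Measure.lintegral_compProd (μ := L) (κ := pointKernel d) hG
  rw [hL.mecke_measure, lintegral_map hG measurable_addPoint,
    lintegral_prod (fun a => Function.uncurry G (addPoint a))
      (hG.comp measurable_addPoint).aemeasurable] at h1
  simp only [pointKernel_apply, Function.uncurry_apply_pair] at h1
  rw [← h1, ← lintegral_const_mul' _ _ ENNReal.coe_ne_top]
  refine lintegral_congr fun X => ?_
  rw [lintegral_smul_measure]
  rfl

end IsHomogeneousPoisson

end RepelledPoisson

/-! ### Moments of sums over the points, and martingale convergence -/

namespace RepelledPoisson

open Set Metric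
open _root_.RepelledPoisson.Configuration

variable {d : ℕ}

theorem Configuration.integrable_countMeasure (X : Configuration d)
    {F : Type*} [NormedAddCommGroup F] [MeasurableSpace F] [BorelSpace F]
    [SecondCountableTopology F]
    {h : EuclideanSpace ℝ (Fin d) → F}
    (hm : Measurable h) {K : ℝ} (hK : ∀ z, ‖h z‖ ≤ K) {A : Set (EuclideanSpace ℝ (Fin d))}
    (hb : Bornology.IsBounded A) (hA : ∀ z ∉ A, h z = 0) : Integrable h X.countMeasure := by
  rw [← integrableOn_iff_integrable_of_support_subset (s := A)]
  · exact Measure.integrableOn_of_bounded (X.countMeasure_lt_top hb).ne hm.aestronglyMeasurable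
      (ae_of_all _ hK)
  · exact fun z hz => by_contra fun hzA => hz (hA z hzA)

theorem integrable_volume_of_bounded {F : Type*} [NormedAddCommGroup F] [MeasurableSpace F]
    [BorelSpace F] [SecondCountableTopology F] {h : EuclideanSpace ℝ (Fin d) → F}
    (hm : Measurable h) {K : ℝ} (hK : ∀ z, ‖h z‖ ≤ K) {A : Set (EuclideanSpace ℝ (Fin d))}
    (hb : Bornology.IsBounded A) (hA : ∀ z ∉ A, h z = 0) : Integrable h := by
  rw [← integrableOn_iff_integrable_of_support_subset (s := A)]
  · exact Measure.integrableOn_of_bounded hb.measure_lt_top.ne hm.aestronglyMeasurable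
      (ae_of_all _ hK)
  · exact fun z hz => by_contra fun hzA => hz (hA z hzA)

/-- The sum of the values of a function at the points of a configuration. -/
noncomputable def pointSum {F : Type*} [NormedAddCommGroup F] [NormedSpace ℝ F]
    (h : EuclideanSpace ℝ (Fin d) → F) (X : Configuration d) : F :=
  ∫ z, h z ∂X.countMeasure

theorem measurable_pointSum {h : EuclideanSpace ℝ (Fin d) → ℝ}
    (hm : Measurable h) : Measurable (pointSum h) :=
  (StronglyMeasurable.integral_kernel (κ := pointKernel d) hm.stronglyMeasurable).measurable

theorem pointSum_insert {h : EuclideanSpace ℝ (Fin d) → ℝ} 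
    {X : Configuration d} (hi : Integrable h X.countMeasure) {z : EuclideanSpace ℝ (Fin d)}
    (hz : z ∉ X) : pointSum h (insert z X) = h z + pointSum h X := by
  rw [pointSum, countMeasure_insert hz, integral_add_measure _ hi, integral_dirac, pointSum]
  exact integrable_dirac (by simp)

namespace IsHomogeneousPoisson

variable {L : Measure (Configuration d)} [IsProbabilityMeasure L] {ρ : ℝ≥0} [NeZero d]

/-- The Mecke formula for integrable functions. -/
theorem mecke_integral (hL : IsHomogeneousPoisson id L ρ)
    {G : Configuration d × EuclideanSpace ℝ (Fin d) → ℝ} (hm : Measurable G)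
    (hG : Integrable (G ∘ addPoint) (L.prod (ρ • volume))) :
    Integrable (fun X => ∫ z, G (X, z) ∂X.countMeasure) L ∧
      ∫ X, ∫ z, G (X, z) ∂X.countMeasure ∂L = ∫ p, G (addPoint p) ∂(L.prod (ρ • volume)) := by
  have hi : Integrable G (L ⊗ₘ pointKernel d) := by
    rw [hL.mecke_measure]
    exact (integrable_map_measure hm.aestronglyMeasurable measurable_addPoint.aemeasurable).2 hG
  constructor
  · refine ((Measure.integrable_compProd_iff hm.aestronglyMeasurable).1 hi).2.mono' ?_
      (ae_of_all _ fun X => norm_integral_le_integral_norm _)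
    exact (StronglyMeasurable.integral_kernel_prod_right' (κ := pointKernel d)
      hm.stronglyMeasurable).aestronglyMeasurable
  · have h := Measure.integral_compProd hi
    rw [hL.mecke_measure, integral_map measurable_addPoint.aemeasurable hm.aestronglyMeasurable] at h
    rw [h]
    rfl

/-- The mean of a sum over the points of a Poisson process, on an event which does not depend on
the points which are summed. -/
theorem setIntegral_pointSum (hL : IsHomogeneousPoisson id L ρ) {h : EuclideanSpace ℝ (Fin d) → ℝ}
    (hm : Measurable h) (hi : Integrable h) {D : Set (Configuration d)} (hD : MeasurableSet D)
    (hDh : ∀ X : Configuration d, ∀ z, h z ≠ 0 → ((insert z X : Configuration d) ∈ D ↔ X ∈ D)) :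
    IntegrableOn (pointSum h) D L ∧
      ∫ X in D, pointSum h X ∂L = L.real D * (ρ * ∫ z, h z) := by
  let G : Configuration d × EuclideanSpace ℝ (Fin d) → ℝ := fun p => D.indicator 1 p.1 * h p.2
  have hGm : Measurable G :=
    ((measurable_one.indicator hD).comp measurable_fst).mul (hm.comp measurable_snd)
  have hG : G ∘ addPoint = G := by
    -- Where `h z ≠ 0`, the event `D` does not see the added point `z`, so Mecke leaves the
    -- integrand unchanged and it factorises.
    ext ⟨X, z⟩
    simp only [G, addPoint, Function.comp]
    by_cases hz : h z = 0
    · simp [hz]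
    · have := hDh X z hz
      by_cases hX : X ∈ D
      · simp [hX, this.2 hX]
      · simp [hX, this]
  have hGi : Integrable G (L.prod (ρ • volume)) :=
    Integrable.mul_prod (f := D.indicator (1 : Configuration d → ℝ)) (g := h)
      ((integrable_const 1).indicator hD) hi.smul_measure_nnreal
  have hGX (X : Configuration d) : ∫ z, G (X, z) ∂X.countMeasure = D.indicator (pointSum h) X := by
    simp only [G, integral_const_mul]
    by_cases hX : X ∈ D <;> simp [hX, pointSum]
  obtain ⟨h1, h2⟩ := hL.mecke_integral hGm (hG.symm ▸ hGi)
  simp_rw [hGX] at h1 h2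
  refine ⟨(integrable_indicator_iff hD).1 h1, ?_⟩
  rw [integral_indicator hD] at h2
  have h3 : ∫ p, G (addPoint p) ∂(L.prod (ρ • volume)) = ∫ p, G p ∂(L.prod (ρ • volume)) :=
    integral_congr_ae (ae_of_all _ fun p => congrFun hG p)
  rw [h2, h3, integral_prod_mul (f := D.indicator (1 : Configuration d → ℝ)) (g := h),
    integral_indicator_one hD, integral_smul_nnreal_measure]
  rfl

theorem integral_pointSum (hL : IsHomogeneousPoisson id L ρ) {h : EuclideanSpace ℝ (Fin d) → ℝ}
    (hm : Measurable h) (hi : Integrable h) :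
    Integrable (pointSum h) L ∧ ∫ X, pointSum h X ∂L = ρ * ∫ z, h z := by
  simpa using hL.setIntegral_pointSum hm hi MeasurableSet.univ (by simp)

/-- Write the square as `∑ S(X) h(z)` over the points, where `S` is the sum of `h`, and apply Mecke:
adding `z` turns `S h(z)` into `(h(z) + S) h(z)`, which splits into the variance `ρ ∫ h²` and the
square of the mean. -/
theorem integral_pointSum_sq (hL : IsHomogeneousPoisson id L ρ) {h : EuclideanSpace ℝ (Fin d) → ℝ}
    (hm : Measurable h) {K : ℝ} (hK : ∀ z, ‖h z‖ ≤ K) {A : Set (EuclideanSpace ℝ (Fin d))}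
    (hb : Bornology.IsBounded A) (hA : ∀ z ∉ A, h z = 0) :
    Integrable (fun X => pointSum h X ^ 2) L ∧
      ∫ X, pointSum h X ^ 2 ∂L = ρ * (∫ z, h z ^ 2) + (ρ * ∫ z, h z) ^ 2 := by
  have hi : Integrable h := integrable_volume_of_bounded hm hK hb hA
  have hi2 : Integrable fun z => h z ^ 2 := by
    refine integrable_volume_of_bounded (K := K ^ 2) (by fun_prop) (fun z => ?_) hb
      fun z hz => by simp [hA z hz]
    rw [norm_pow]
    exact pow_le_pow_left₀ (norm_nonneg _) (hK z) 2
  obtain ⟨hSi, hS⟩ := hL.integral_pointSum hm hi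
  let G : Configuration d × EuclideanSpace ℝ (Fin d) → ℝ := fun p => pointSum h p.1 * h p.2
  let G' : Configuration d × EuclideanSpace ℝ (Fin d) → ℝ :=
    fun p => 1 * h p.2 ^ 2 + pointSum h p.1 * h p.2
  have hGm : Measurable G :=
    ((measurable_pointSum hm).comp measurable_fst).mul (hm.comp measurable_snd)
  have hae : ∀ᵐ p ∂(L.prod (ρ • (volume : Measure (EuclideanSpace ℝ (Fin d))))), p.2 ∉ p.1 := by
    refine (Measure.ae_prod_iff_ae_ae (p := fun p => p.2 ∉ p.1) measurableSet_mem.compl).2 ?_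
    exact ae_of_all _ fun X => Measure.ae_smul_measure (ae_notMem X) _
  have hGG : G ∘ addPoint =ᵐ[L.prod (ρ • volume)] G' := by
    filter_upwards [hae] with ⟨X, z⟩ hz
    simp only [G, G', addPoint, Function.comp]
    rw [pointSum_insert (X.integrable_countMeasure hm hK hb hA) hz]
    ring
  have hI1 : Integrable (fun p : Configuration d × EuclideanSpace ℝ (Fin d) => 1 * h p.2 ^ 2)
      (L.prod (ρ • volume)) :=
    Integrable.mul_prod (f := fun _ : Configuration d => (1 : ℝ)) (g := fun z => h z ^ 2)
      (integrable_const 1) hi2.smul_measure_nnreal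
  have hI2 : Integrable (fun p : Configuration d × EuclideanSpace ℝ (Fin d) =>
      pointSum h p.1 * h p.2) (L.prod (ρ • volume)) :=
    Integrable.mul_prod (f := pointSum h) (g := h) hSi hi.smul_measure_nnreal
  have hGX (X : Configuration d) : ∫ z, G (X, z) ∂X.countMeasure = pointSum h X ^ 2 := by
    simp only [G, integral_const_mul]
    rw [sq]
    rfl
  obtain ⟨h1, h2⟩ := hL.mecke_integral hGm ((hI1.add hI2).congr hGG.symm)
  simp_rw [hGX] at h1 h2
  refine ⟨h1, ?_⟩
  have h3 : ∫ p, G (addPoint p) ∂(L.prod (ρ • volume)) = ∫ p, G' p ∂(L.prod (ρ • volume)) :=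
    integral_congr_ae hGG
  rw [h2, h3, integral_add hI1 hI2,
    integral_prod_mul (f := fun _ : Configuration d => (1 : ℝ)) (g := fun z => h z ^ 2),
    integral_prod_mul (f := pointSum h) (g := h), integral_smul_nnreal_measure,
    integral_smul_nnreal_measure, hS]
  simp only [integral_const, probReal_univ, NNReal.smul_def, smul_eq_mul]
  ring

/-- The compensated sum of a bounded square-integrable function over the points of a Poisson
process which are in `A n` converges almost surely. -/
theorem ae_exists_tendsto_compensated (hL : IsHomogeneousPoisson id L ρ)
    {g : EuclideanSpace ℝ (Fin d) → ℝ} (hm : Measurable g) {K : ℝ} (hK : ∀ z, ‖g z‖ ≤ K)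
    (hg : Integrable fun z => g z ^ 2) {A : ℕ → Set (EuclideanSpace ℝ (Fin d))}
    (hA : ∀ n, MeasurableSet (A n)) (hb : ∀ n, Bornology.IsBounded (A n)) (hmono : Monotone A) :
    ∀ᵐ X ∂L, ∃ c, Tendsto (fun n => pointSum ((A n).indicator g) X - ρ * ∫ z in A n, g z)
      atTop (𝓝 c) := by
  have hhm (n) : Measurable ((A n).indicator g) := hm.indicator (hA n)
  have hhK (n) (z) : ‖(A n).indicator g z‖ ≤ K := (norm_indicator_le_norm_self _ _).trans (hK z)
  have hh0 (n) (z) (hz : z ∉ A n) : (A n).indicator g z = 0 := indicator_of_notMem hz _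
  have hhi (n) : Integrable ((A n).indicator g) :=
    integrable_volume_of_bounded (hhm n) (hhK n) (hb n) (hh0 n)
  have hhX (n) (X : Configuration d) : Integrable ((A n).indicator g) X.countMeasure :=
    X.integrable_countMeasure (hhm n) (hhK n) (hb n) (hh0 n)
  let T : ℕ → Configuration d → ℝ := fun n X =>
    pointSum ((A n).indicator g) X - ρ * ∫ z in A n, g z
  -- At time `n`, the information is the configuration inside `A n`.
  let 𝓕 : Filtration ℕ (inferInstance : MeasurableSpace (Configuration d)) :=
    { seq := fun n => MeasurableSpace.comap (fun X : Configuration d => X.restrict (A n)) inferInstance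
      mono' := by
        intro m n hmn
        rw [← measurable_iff_comap_le]
        have : (fun X : Configuration d => X.restrict (A m)) =
            (fun X : Configuration d => X.restrict (A m)) ∘ fun X => X.restrict (A n) := by
          ext1 X
          simp only [Function.comp]
          rw [restrict_restrict, inter_eq_self_of_subset_right (hmono hmn)]
        rw [this]
        exact (measurable_restrict (hA m)).comp (comap_measurable _)
      le' := fun n => measurable_iff_comap_le.1 (measurable_restrict (hA n)) }
  have hTadp : StronglyAdapted 𝓕 T := by
    intro n
    have : T n = T n ∘ fun X => X.restrict (A n) := by
      ext X
      simp only [T, Function.comp, pointSum, countMeasure_restrict _ (hA n)]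
      rw [integral_indicator (hA n), integral_indicator (hA n), Measure.restrict_restrict (hA n),
        inter_self]
    rw [this]
    exact (((measurable_pointSum (hhm n)).sub_const _).comp (comap_measurable _)).stronglyMeasurable
  have hTint (n) : Integrable (T n) L :=
    (hL.integral_pointSum (hhm n) (hhi n)).1.sub (integrable_const _)
  have hmart : Martingale T 𝓕 L := by
    refine martingale_of_setIntegral_eq_succ hTadp hTint fun n D hD => ?_
    obtain ⟨D', hD', rfl⟩ := hD
    set D := (fun X : Configuration d => X.restrict (A n)) ⁻¹' D'
    have hDm : MeasurableSet D := measurable_restrict (hA n) hD'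
    let h := (A (n + 1) \ A n).indicator g
    have hsub := hmono n.le_succ
    have hdecomp (z) : (A (n + 1)).indicator g z = (A n).indicator g z + h z := by
      by_cases h1 : z ∈ A n
      · simp [h, h1, hsub h1]
      · by_cases h2 : z ∈ A (n + 1) <;> simp [h, h1, h2]
    have hhm' : Measurable h := hm.indicator ((hA _).diff (hA _))
    have hhK' (z) : ‖h z‖ ≤ K := (norm_indicator_le_norm_self _ _).trans (hK z)
    have hh0' (z) (hz : z ∉ A (n + 1)) : h z = 0 := indicator_of_notMem (fun hz' => hz hz'.1) _
    have hhi' : Integrable h := integrable_volume_of_bounded hhm' hhK' (hb _) hh0'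
    -- The increment sums over `A (n + 1) \ A n`, while `D` depends only on the configuration inside
    -- `A n`; hence the compensated increment has zero mean on `D`.
    obtain ⟨e1, e2⟩ := hL.setIntegral_pointSum hhm' hhi' hDm fun X z hz => by
      have : z ∉ A n := fun h1 => hz (indicator_of_notMem (fun h2 => h2.2 h1) _)
      simp only [D, mem_preimage, restrict_insert_of_notMem X this]
    have hT (X : Configuration d) : T (n + 1) X = T n X + (pointSum h X - ρ * ∫ z, h z) := by
      simp only [T]
      rw [← integral_indicator (hA _), ← integral_indicator (hA _)]
      simp_rw [pointSum, hdecomp]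
      rw [integral_add (hhX n X) (X.integrable_countMeasure hhm' hhK' (hb _) hh0'),
        integral_add (hhi n) hhi']
      ring
    simp_rw [hT]
    have e1' : IntegrableOn (fun X => pointSum h X - ρ * ∫ z, h z) D L := e1.sub (integrable_const _)
    rw [integral_add (hTint n).integrableOn e1',
      integral_sub e1 (integrable_const _), e2]
    simp
  -- The L¹ bound comes from `|t| ≤ 1 + t²` and from the variance of `T n`, which is at most `ρ ∫
  -- g²`.
  refine hmart.submartingale.exists_ae_tendsto_of_bdd (R := (1 + ρ * ∫ z, g z ^ 2).toNNReal)
    fun n => ?_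
  obtain ⟨e1, e2⟩ := hL.integral_pointSum_sq (hhm n) (hhK n) (hb n) (hh0 n)
  obtain ⟨e3, e4⟩ := hL.integral_pointSum (hhm n) (hhi n)
  set c := ρ * ∫ z in A n, g z with hc
  have hc' : ρ * ∫ z, (A n).indicator g z = c := by rw [integral_indicator (hA n)]
  have hTsq (X) : T n X ^ 2 = pointSum ((A n).indicator g) X ^ 2 -
      (2 * c) * pointSum ((A n).indicator g) X + c ^ 2 := by
    simp only [T]; ring
  have i1 : Integrable (fun X => pointSum ((A n).indicator g) X ^ 2 -
      (2 * c) * pointSum ((A n).indicator g) X) L := e1.sub (e3.const_mul _)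
  have hTsqi : Integrable (fun X => T n X ^ 2) L := by
    simp_rw [hTsq]
    exact i1.add (integrable_const _)
  have hvar : ∫ X, T n X ^ 2 ∂L = ρ * ∫ z, (A n).indicator g z ^ 2 := by
    simp_rw [hTsq]
    rw [integral_add i1 (integrable_const _), integral_sub e1 (e3.const_mul _), e2,
      integral_const_mul, e4, hc']
    simp only [integral_const, probReal_univ, smul_eq_mul]
    ring
  have hle : ∫ z, (A n).indicator g z ^ 2 ≤ ∫ z, g z ^ 2 := by
    refine integral_mono_of_nonneg (ae_of_all _ fun z => sq_nonneg _) hg (ae_of_all _ fun z => ?_)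
    by_cases hz : z ∈ A n
    · simp [hz]
    · simp [hz, sq_nonneg]
  rw [eLpNorm_one_eq_lintegral_enorm, ← ofReal_integral_norm_eq_lintegral_enorm (hTint n)]
  refine ENNReal.ofReal_le_ofReal ?_
  calc ∫ X, ‖T n X‖ ∂L ≤ ∫ X, (1 + T n X ^ 2) ∂L := by
        refine integral_mono (hTint n).norm ((integrable_const _).add hTsqi) fun X => ?_
        simp only [Real.norm_eq_abs]
        nlinarith [sq_nonneg (|T n X| - 1), sq_abs (T n X)]
    _ = 1 + ρ * ∫ z, (A n).indicator g z ^ 2 := by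
        rw [integral_add (integrable_const _) hTsqi, hvar]
        simp
    _ ≤ _ := by gcongr

end IsHomogeneousPoisson

end RepelledPoisson

/-! ### Estimates for the Coulomb kernel -/

namespace RepelledPoisson

open Set Metric

variable {d : ℕ}

/-- The Coulomb kernel `u / ‖u‖^d`. -/
noncomputable def coulomb (u : EuclideanSpace ℝ (Fin d)) : EuclideanSpace ℝ (Fin d) :=
  (‖u‖ ^ d)⁻¹ • u

theorem coulomb_zero : coulomb (0 : EuclideanSpace ℝ (Fin d)) = 0 := smul_zero _

theorem coulomb_neg (u : EuclideanSpace ℝ (Fin d)) : coulomb (-u) = -coulomb u := by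
  simp [coulomb]

theorem measurable_coulomb : Measurable (coulomb (d := d)) := by
  unfold coulomb
  fun_prop

theorem norm_coulomb [NeZero d] (u : EuclideanSpace ℝ (Fin d)) (hu : u ≠ 0) :
    ‖coulomb u‖ = (‖u‖ ^ (d - 1))⁻¹ := by
  have h := norm_ne_zero_iff.2 hu
  rw [coulomb, norm_smul, norm_inv, norm_pow, norm_norm, ← pow_sub_one_mul (NeZero.ne d)]
  field_simp

theorem coulomb_smul [NeZero d] {t : ℝ} (ht : 0 < t) (u : EuclideanSpace ℝ (Fin d)) :
    coulomb (t • u) = (t ^ (d - 1))⁻¹ • coulomb u := by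
  rw [coulomb, coulomb, norm_smul, Real.norm_of_nonneg ht.le, smul_smul, smul_smul,
    mul_pow, ← pow_sub_one_mul (NeZero.ne d) t]
  congr 1
  field_simp

theorem contDiffAt_coulomb {u : EuclideanSpace ℝ (Fin d)} (hu : u ≠ 0) :
    ContDiffAt ℝ 2 coulomb u := by
  unfold coulomb
  refine ContDiffAt.smul (ContDiffAt.inv ((contDiffAt_norm ℝ hu).pow d) ?_) contDiffAt_id
  exact pow_ne_zero _ (norm_ne_zero_iff.2 hu)

/-- For a unit vector `u` and `‖k‖ ≤ 1/2`, the segment from `u` to `u + k` stays in the annulus `1/2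
≤ ‖v‖ ≤ 3/2`. It is compact and avoids the singularity, so the second derivative is bounded there.
-/
theorem exists_norm_coulomb_taylor_le_of_norm_eq_one :
    ∃ C, 0 ≤ C ∧ ∀ u k : EuclideanSpace ℝ (Fin d), ‖u‖ = 1 → ‖k‖ ≤ 1 / 2 →
      ‖coulomb (u + k) - coulomb u - fderiv ℝ coulomb u k‖ ≤ C * ‖k‖ ^ 2 := by
  have hK : IsCompact {u : EuclideanSpace ℝ (Fin d) | 1 / 2 ≤ ‖u‖ ∧ ‖u‖ ≤ 3 / 2} := by
    have : {u : EuclideanSpace ℝ (Fin d) | 1 / 2 ≤ ‖u‖ ∧ ‖u‖ ≤ 3 / 2} =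
        closedBall 0 (3 / 2) ∩ {u | 1 / 2 ≤ ‖u‖} := by
      ext u; simp [and_comm]
    rw [this]
    exact (isCompact_closedBall _ _).inter_right (isClosed_le continuous_const continuous_norm)
  have hne {u : EuclideanSpace ℝ (Fin d)} (hu : 1 / 2 ≤ ‖u‖) : u ≠ 0 := by
    rintro rfl
    norm_num at hu
  have hcd {u : EuclideanSpace ℝ (Fin d)} (hu : 1 / 2 ≤ ‖u‖) :
      ContDiffAt ℝ 1 (fderiv ℝ (coulomb (d := d))) u :=
    (contDiffAt_coulomb (hne hu)).fderiv_right (by norm_num)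
  have hcont : ContinuousOn (fderiv ℝ (fderiv ℝ (coulomb (d := d))))
      {u | 1 / 2 ≤ ‖u‖ ∧ ‖u‖ ≤ 3 / 2} := fun u hu =>
    ((hcd hu.1).fderiv_right (m := 0) (by norm_num)).continuousAt.continuousWithinAt
  obtain ⟨C, hC⟩ := hK.exists_bound_of_continuousOn (E := EuclideanSpace ℝ (Fin d) →L[ℝ]
    EuclideanSpace ℝ (Fin d) →L[ℝ] EuclideanSpace ℝ (Fin d)) hcont
  refine ⟨max C 0, le_max_right _ _, fun u k hu hk => ?_⟩
  have hball {v : EuclideanSpace ℝ (Fin d)} (hv : v ∈ closedBall u ‖k‖) :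
      1 / 2 ≤ ‖v‖ ∧ ‖v‖ ≤ 3 / 2 := by
    rw [mem_closedBall, dist_eq_norm] at hv
    have h1 := norm_sub_norm_le u v
    have h2 := norm_sub_norm_le v u
    rw [norm_sub_rev] at h1
    constructor <;> linarith
  have hder {v : EuclideanSpace ℝ (Fin d)} (hv : v ∈ closedBall u ‖k‖) :
      ‖fderiv ℝ coulomb v - fderiv ℝ coulomb u‖ ≤ max C 0 * ‖k‖ := by
    refine ((convex_closedBall u ‖k‖).norm_image_sub_le_of_norm_fderiv_le
      (fun w hw => (hcd (hball hw).1).differentiableAt one_ne_zero)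
      (fun w hw => (hC w (hball hw)).trans (le_max_left C 0))
      (mem_closedBall_self (norm_nonneg _)) hv).trans ?_
    rw [mem_closedBall, dist_eq_norm] at hv
    gcongr
  -- Second use of the mean value inequality, now for the kernel minus its derivative at `u`; the
  -- first one bounded the variation of the derivative by a multiple of `‖k‖`.
  have := (convex_closedBall u ‖k‖).norm_image_sub_le_of_norm_fderiv_le' (𝕜 := ℝ) (f := coulomb)
    (φ := fderiv ℝ coulomb u) (C := max C 0 * ‖k‖) (x := u) (y := u + k)
    (fun w hw => (contDiffAt_coulomb (hne (hball hw).1)).differentiableAt two_ne_zero)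
    (fun w hw => hder hw) (mem_closedBall_self (norm_nonneg _)) (by simp)
  rw [add_sub_cancel_left] at this
  linarith [this, show max C 0 * ‖k‖ * ‖k‖ = max C 0 * ‖k‖ ^ 2 by ring]

/-- By homogeneity of degree `-(d-1)`, rescale to the unit sphere: the increment becomes `k / ‖u‖`,
of norm at most `1/2`, and the error is of order `‖u‖^(-(d-1)) ‖u‖^(-2)`. Only the linearity of `D`
matters for the sequel. -/
theorem exists_norm_coulomb_taylor_le [NeZero d] :
    ∃ C, 0 ≤ C ∧ ∀ u : EuclideanSpace ℝ (Fin d), 2 ≤ ‖u‖ →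
      ∃ D : EuclideanSpace ℝ (Fin d) →ₗ[ℝ] EuclideanSpace ℝ (Fin d), ∀ k, ‖k‖ ≤ 1 →
        ‖coulomb (u + k) - coulomb u - D k‖ ≤ C * (‖u‖ ^ (d + 1))⁻¹ := by
  obtain ⟨C, hC0, hC⟩ := exists_norm_coulomb_taylor_le_of_norm_eq_one (d := d)
  refine ⟨C, hC0, fun u hu => ?_⟩
  have hu0 : 0 < ‖u‖ := by linarith
  let v := ‖u‖⁻¹ • u
  have hv : ‖v‖ = 1 := by
    simp only [v, norm_smul, norm_inv, norm_norm]
    field_simp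
  have huv : u = ‖u‖ • v := by simp only [v]; rw [smul_inv_smul₀ hu0.ne']
  refine ⟨(‖u‖ ^ (d - 1))⁻¹ • ‖u‖⁻¹ • (fderiv ℝ coulomb v).toLinearMap, fun k hk => ?_⟩
  have h1 : coulomb (u + k) = (‖u‖ ^ (d - 1))⁻¹ • coulomb (v + ‖u‖⁻¹ • k) := by
    rw [← coulomb_smul hu0, smul_add, ← huv, smul_inv_smul₀ hu0.ne']
  have h2 : coulomb u = (‖u‖ ^ (d - 1))⁻¹ • coulomb v := by
    rw [← coulomb_smul hu0, ← huv]
  have h3 : ‖‖u‖⁻¹ • k‖ ≤ ‖u‖⁻¹ := by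
    rw [norm_smul, norm_inv, norm_norm]
    exact mul_le_of_le_one_right (by positivity) hk
  have h4 := hC v (‖u‖⁻¹ • k) hv (h3.trans (by
    rw [inv_eq_one_div]; exact one_div_le_one_div_of_le two_pos hu))
  rw [h1, h2, LinearMap.smul_apply, LinearMap.smul_apply, ← smul_sub, ContinuousLinearMap.coe_coe,
    ← map_smul, ← smul_sub, norm_smul, norm_inv, norm_pow, norm_norm]
  calc (‖u‖ ^ (d - 1))⁻¹ * _ ≤ (‖u‖ ^ (d - 1))⁻¹ * (C * ‖u‖⁻¹ ^ 2) := by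
        gcongr
        exact h4.trans (by gcongr)
    _ = C * (‖u‖ ^ (d + 1))⁻¹ := by
        rw [pow_succ ‖u‖ d, ← pow_sub_one_mul (NeZero.ne d) ‖u‖]
        field_simp

/-- The Coulomb kernel without its singularity. -/
noncomputable def coulombTail (u : EuclideanSpace ℝ (Fin d)) : EuclideanSpace ℝ (Fin d) :=
  (ball (0 : EuclideanSpace ℝ (Fin d)) 1)ᶜ.indicator coulomb u

theorem measurable_coulombTail : Measurable (coulombTail (d := d)) :=
  measurable_coulomb.indicator measurableSet_ball.compl

theorem coulombTail_neg (u : EuclideanSpace ℝ (Fin d)) : coulombTail (-u) = -coulombTail u := by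
  by_cases h : ‖u‖ < 1 <;> simp [coulombTail, indicator, h, coulomb_neg]

theorem coulombTail_of_one_le {u : EuclideanSpace ℝ (Fin d)} (hu : 1 ≤ ‖u‖) :
    coulombTail u = coulomb u := by
  simp [coulombTail, hu]

/-- A bounded function which decays as the Coulomb kernel. -/
noncomputable def decay (n : ℕ) (u : EuclideanSpace ℝ (Fin d)) : ℝ := ((1 + ‖u‖) ^ n)⁻¹

theorem decay_nonneg (n : ℕ) (u : EuclideanSpace ℝ (Fin d)) : 0 ≤ decay n u := by
  unfold decay; positivity

theorem decay_le_one (n : ℕ) (u : EuclideanSpace ℝ (Fin d)) : decay n u ≤ 1 :=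
  inv_le_one_of_one_le₀ (one_le_pow₀ (by linarith [norm_nonneg u]))

theorem measurable_decay (n : ℕ) : Measurable (decay (d := d) n) := by
  unfold decay
  fun_prop

theorem decay_add_le (n : ℕ) (u v : EuclideanSpace ℝ (Fin d)) :
    decay n (u + v) ≤ (1 + ‖v‖) ^ n * decay n u := by
  unfold decay
  rw [← div_eq_mul_inv, inv_eq_one_div, div_le_div_iff₀ (by positivity) (by positivity), one_mul,
    ← mul_pow]
  gcongr
  have h : ‖u‖ ≤ ‖u + v‖ + ‖v‖ := by simpa using norm_sub_le (u + v) v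
  nlinarith [mul_nonneg (norm_nonneg v) (norm_nonneg (u + v))]

theorem integrable_decay {n : ℕ} (hn : d < n) :
    Integrable (decay (d := d) n) := by
  have := integrable_one_add_norm (E := EuclideanSpace ℝ (Fin d)) (μ := volume) (r := n)
    (by simpa using hn)
  refine this.congr (ae_of_all _ fun u => ?_)
  simp only [decay]
  rw [Real.rpow_neg (by positivity), Real.rpow_natCast]

theorem norm_coulombTail_le [NeZero d] (u : EuclideanSpace ℝ (Fin d)) :
    ‖coulombTail u‖ ≤ 2 ^ (d - 1) * decay (d - 1) u := by
  by_cases h : 1 ≤ ‖u‖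
  · have hu : u ≠ 0 := by rintro rfl; norm_num at h
    rw [coulombTail_of_one_le h, norm_coulomb u hu, decay, ← div_eq_mul_inv, inv_eq_one_div,
      div_le_div_iff₀ (by positivity) (by positivity), one_mul, ← mul_pow]
    gcongr
    linarith
  · have : coulombTail u = 0 := indicator_of_notMem (by simpa using h) _
    rw [this, norm_zero]
    have := decay_nonneg (d - 1) u
    positivity

theorem norm_coulombTail_le_one [NeZero d] (u : EuclideanSpace ℝ (Fin d)) :
    ‖coulombTail u‖ ≤ 1 := by
  by_cases h : 1 ≤ ‖u‖
  · have hu : u ≠ 0 := by rintro rfl; norm_num at h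
    rw [coulombTail_of_one_le h, norm_coulomb u hu]
    exact inv_le_one_of_one_le₀ (one_le_pow₀ h)
  · have : coulombTail u = 0 := indicator_of_notMem (by simpa using h) _
    simp [this]

/-- The error in the approximation of `coulombTail (u + k)` by an affine function of `k` which is
exact at the origin and at the vectors of the canonical basis. -/
noncomputable def affineError (k u : EuclideanSpace ℝ (Fin d)) : EuclideanSpace ℝ (Fin d) :=
  coulombTail (u + k) - coulombTail u -
    ∑ i, k i • (coulombTail (u + EuclideanSpace.single i 1) - coulombTail u)

/-- For large `u`, the linear term of the Taylor expansion cancels by linearity, and the remainders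
at `k` and at the `d` basis vectors are left. For `‖u‖ < 2` the crude bound `2 + 2d` is enough. The
powers of `2` and `3` compare `‖u‖^(-(d+1))`, respectively a constant, with `decay (d + 1) u`. The
decay is integrable because `d + 1 > d`. -/
theorem exists_norm_affineError_le [NeZero d] :
    ∃ C, 0 ≤ C ∧ ∀ k u : EuclideanSpace ℝ (Fin d), ‖k‖ ≤ 1 →
      ‖affineError k u‖ ≤ C * decay (d + 1) u := by
  obtain ⟨C, hC0, hC⟩ := exists_norm_coulomb_taylor_le (d := d)
  refine ⟨max (C * (1 + d) * 2 ^ (d + 1)) ((2 + 2 * d) * 3 ^ (d + 1)), by positivity,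
    fun k u hk => ?_⟩
  have hki (i) : |k i| ≤ 1 := by
    have := EuclideanSpace.norm_eq k
    exact (PiLp.norm_apply_le k i).trans hk
  by_cases hu : 2 ≤ ‖u‖
  · obtain ⟨D, hD⟩ := hC u hu
    have hT {v : EuclideanSpace ℝ (Fin d)} (hv : ‖v‖ ≤ 1) :
        coulombTail (u + v) = coulomb (u + v) := by
      refine coulombTail_of_one_le ?_
      have h : ‖u‖ ≤ ‖u + v‖ + ‖v‖ := by simpa using norm_sub_le (u + v) v
      linarith
    have hT0 : coulombTail u = coulomb u := coulombTail_of_one_le (by linarith)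
    let r (v : EuclideanSpace ℝ (Fin d)) := coulomb (u + v) - coulomb u - D v
    have hkD : D k = ∑ i, k i • D (EuclideanSpace.single i 1) := by
      conv_lhs => rw [← (EuclideanSpace.basisFun (Fin d) ℝ).sum_repr k]
      simp
    have hr : affineError k u = r k - ∑ i, k i • r (EuclideanSpace.single i 1) := by
      simp only [affineError, r, smul_sub, Finset.sum_sub_distrib, hT hk, hT0, hkD]
      rw [Finset.sum_congr rfl fun i _ => by rw [hT (v := EuclideanSpace.single i 1) (by simp)]]
      abel
    have hsum : ‖∑ i, k i • r (EuclideanSpace.single i 1)‖ ≤ d * (C * (‖u‖ ^ (d + 1))⁻¹) := by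
      refine (norm_sum_le _ _).trans ((Finset.sum_le_card_nsmul _ _ (C * (‖u‖ ^ (d + 1))⁻¹)
        fun i _ => ?_).trans (by simp))
      rw [norm_smul, Real.norm_eq_abs]
      exact (mul_le_of_le_one_left (norm_nonneg _) (hki i)).trans (hD _ (by simp))
    have hdec : (‖u‖ ^ (d + 1))⁻¹ ≤ 2 ^ (d + 1) * decay (d + 1) u := by
      rw [decay, ← div_eq_mul_inv, inv_eq_one_div,
        div_le_div_iff₀ (by positivity) (by positivity), one_mul, ← mul_pow]
      gcongr
      linarith
    calc ‖affineError k u‖ ≤ ‖r k‖ + ‖∑ i, k i • r (EuclideanSpace.single i 1)‖ := by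
          rw [hr]; exact norm_sub_le _ _
      _ ≤ C * (‖u‖ ^ (d + 1))⁻¹ + d * (C * (‖u‖ ^ (d + 1))⁻¹) := add_le_add (hD k hk) hsum
      _ = C * (1 + d) * (‖u‖ ^ (d + 1))⁻¹ := by ring
      _ ≤ C * (1 + d) * (2 ^ (d + 1) * decay (d + 1) u) := by gcongr
      _ = C * (1 + d) * 2 ^ (d + 1) * decay (d + 1) u := by ring
      _ ≤ _ := by
        gcongr
        · exact decay_nonneg _ _
        · exact le_max_left _ _
  · have hsum : ‖∑ i, k i • (coulombTail (u + EuclideanSpace.single i 1) - coulombTail u)‖ ≤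
        2 * d := by
      refine (norm_sum_le _ _).trans ((Finset.sum_le_card_nsmul _ _ 2
        fun i _ => ?_).trans (by simp [mul_comm]))
      rw [norm_smul, Real.norm_eq_abs]
      refine (mul_le_of_le_one_left (norm_nonneg _) (hki i)).trans ((norm_sub_le _ _).trans ?_)
      linarith [norm_coulombTail_le_one (u + EuclideanSpace.single i 1), norm_coulombTail_le_one u]
    have h1 : ‖affineError k u‖ ≤ 2 + 2 * d := by
      refine (norm_sub_le _ _).trans (add_le_add ((norm_sub_le _ _).trans ?_) hsum)
      linarith [norm_coulombTail_le_one (u + k), norm_coulombTail_le_one u]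
    have h2 : 1 ≤ 3 ^ (d + 1) * decay (d + 1) u := by
      rw [decay, ← div_eq_mul_inv, one_le_div (by positivity)]
      gcongr
      linarith
    calc ‖affineError k u‖ ≤ (2 + 2 * d) * 1 := by linarith
      _ ≤ (2 + 2 * d) * (3 ^ (d + 1) * decay (d + 1) u) := by gcongr
      _ = (2 + 2 * d) * 3 ^ (d + 1) * decay (d + 1) u := by ring
      _ ≤ _ := by
        gcongr
        · exact decay_nonneg _ _
        · exact le_max_right _ _

/-- The integral of the decay function over a shell is at most proportional to its width. -/
theorem exists_setIntegral_decay_shell_le [NeZero d] :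
    ∃ C, 0 ≤ C ∧ ∀ (c : EuclideanSpace ℝ (Fin d)) (a h : ℝ), 0 ≤ a → 0 ≤ h → h ≤ 3 →
      ∫ z in closedBall c (a + h) \ closedBall c a, decay (d - 1) (z - c) ≤ C * h := by
  have : Nontrivial (EuclideanSpace ℝ (Fin d)) := inferInstance
  set ω := volume.real (closedBall (0 : EuclideanSpace ℝ (Fin d)) 1) with hω
  refine ⟨ω * d * 3 ^ (d - 1), by positivity, fun c a h ha hh h3 => ?_⟩
  have hvol (r : ℝ) (hr : 0 ≤ r) : volume.real (closedBall c r) = r ^ d * ω := by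
    rw [measureReal_def, Measure.addHaar_closedBall' _ _ hr, ENNReal.toReal_mul,
      ENNReal.toReal_ofReal (by positivity), finrank_euclideanSpace_fin]
    rfl
  have hshell : volume.real (closedBall c (a + h) \ closedBall c a) =
      ((a + h) ^ d - a ^ d) * ω := by
    rw [measureReal_sdiff (closedBall_subset_closedBall (by linarith)) measurableSet_closedBall
      isBounded_closedBall.measure_lt_top.ne,
      hvol _ (by positivity), hvol _ ha]
    · ring
  -- Since `h ≤ 3`, the outer radius is at most `3 (1 + a)`; the power `d - 1` of `1 + a` then
  -- cancels against the decay on the shell.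
  have hpow : (a + h) ^ d - a ^ d ≤ h * d * (3 * (1 + a)) ^ (d - 1) := by
    have h1 := abs_pow_sub_pow_le (a + h) a d
    rw [add_sub_cancel_left, abs_of_nonneg hh, abs_of_nonneg ha, abs_of_nonneg (a := a + h) (by positivity),
      max_eq_left (by linarith)] at h1
    refine (le_abs_self _).trans (h1.trans ?_)
    gcongr
    linarith
  calc ∫ z in closedBall c (a + h) \ closedBall c a, decay (d - 1) (z - c)
      ≤ ((1 + a) ^ (d - 1))⁻¹ * volume.real (closedBall c (a + h) \ closedBall c a) := by
        refine (le_abs_self _).trans ?_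
        rw [← Real.norm_eq_abs]
        refine norm_setIntegral_le_of_norm_le_const ?_ fun z hz => ?_
        · exact (isBounded_closedBall.subset sdiff_subset).measure_lt_top
        · rw [Real.norm_of_nonneg (decay_nonneg _ _), decay]
          have : a ≤ ‖z - c‖ := by
            have := hz.2
            rw [mem_closedBall, dist_eq_norm] at this
            linarith
          gcongr
    _ ≤ ((1 + a) ^ (d - 1))⁻¹ * (h * d * (3 * (1 + a)) ^ (d - 1) * ω) := by
        rw [hshell]; gcongr
    _ = _ := by
        rw [mul_pow]
        field_simp

end RepelledPoisson

/-! ### A deterministic criterion for validity -/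

namespace RepelledPoisson

open Set Metric

variable {d : ℕ}

theorem Configuration.integrableOn_countMeasure (X : Configuration d)
    {F : Type*} [NormedAddCommGroup F] (φ : EuclideanSpace ℝ (Fin d) → F)
    {B : Set (EuclideanSpace ℝ (Fin d))} (hB : MeasurableSet B) (hb : Bornology.IsBounded B) :
    IntegrableOn φ B X.countMeasure := by
  have hf := X.finite_inter_of_isBounded hb
  rw [IntegrableOn, countMeasure, Measure.restrict_restrict hB, inter_comm]
  have : IsFiniteMeasure (Measure.count.restrict ((X : Set (EuclideanSpace ℝ (Fin d))) ∩ B)) :=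
    ⟨by rw [Measure.restrict_apply_univ]; exact Measure.count_apply_lt_top.2 hf⟩
  have h := IntegrableOn.of_finite (f := φ) hf
    (μ := Measure.count.restrict ((X : Set (EuclideanSpace ℝ (Fin d))) ∩ B))
  rwa [IntegrableOn, Measure.restrict_restrict hf.measurableSet, inter_self] at h

theorem Configuration.setIntegral_countMeasure (X : Configuration d)
    {F : Type*} [NormedAddCommGroup F] [NormedSpace ℝ F] [CompleteSpace F]
    (φ : EuclideanSpace ℝ (Fin d) → F)
    {B : Set (EuclideanSpace ℝ (Fin d))} (hB : MeasurableSet B) (hb : Bornology.IsBounded B) :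
    ∫ z in B, φ z ∂X.countMeasure = ∑ᶠ z ∈ (X : Set (EuclideanSpace ℝ (Fin d))) ∩ B, φ z := by
  have hf := X.finite_inter_of_isBounded hb
  have hi := X.integrableOn_countMeasure φ hB hb
  rw [IntegrableOn] at hi
  rw [countMeasure, Measure.restrict_restrict hB, inter_comm] at hi ⊢
  rw [finsum_mem_eq_finite_toFinset_sum _ hf]
  have := setIntegral_finset (μ := Measure.count) (f := φ) hf.toFinset (by
    rw [hf.coe_toFinset]; exact hi)
  rw [hf.coe_toFinset] at this
  rw [this]
  simp [measureReal_def]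

/-- The point `x` need not be removed from the sum, because `coulomb 0 = 0`. -/
theorem partialForce_eq_setIntegral (X : Configuration d) (x : EuclideanSpace ℝ (Fin d)) (R : ℝ) :
    partialForce X x R = ∫ z in closedBall x R, coulomb (x - z) ∂X.countMeasure := by
  rw [X.setIntegral_countMeasure _ measurableSet_closedBall isBounded_closedBall, partialForce]
  refine finsum_mem_inter_support_eq (fun z => coulomb (x - z)) _ _ ?_
  ext z
  simp only [mem_inter_iff, Set.mem_sdiff, mem_singleton_iff, Function.mem_support]
  constructor
  · rintro ⟨⟨⟨hz, -⟩, hb⟩, h0⟩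
    exact ⟨⟨hz, hb⟩, h0⟩
  · rintro ⟨⟨hz, hb⟩, h0⟩
    refine ⟨⟨⟨hz, ?_⟩, hb⟩, h0⟩
    rintro rfl
    exact h0 (by rw [sub_self, coulomb_zero])

/-- The difference between a sum over the points of a configuration and its mean. -/
noncomputable def compensated {F : Type*} [NormedAddCommGroup F] [NormedSpace ℝ F] (ρ : ℝ)
    (X : Configuration d) (φ : EuclideanSpace ℝ (Fin d) → F)
    (A : Set (EuclideanSpace ℝ (Fin d))) : F :=
  ∫ z in A, φ z ∂X.countMeasure - ρ • ∫ z in A, φ z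

/-- Convergence of the compensated sums over the balls around `c` with radius a multiple
of `h`, for a bounded function. -/
structure ConvergesAlong {F : Type*} [NormedAddCommGroup F] [NormedSpace ℝ F] (ρ : ℝ)
    (X : Configuration d) (c : EuclideanSpace ℝ (Fin d)) (h : ℝ)
    (φ : EuclideanSpace ℝ (Fin d) → F) : Prop where
  stronglyMeasurable : StronglyMeasurable φ
  bounded : ∃ K : ℝ, ∀ z, ‖φ z‖ ≤ K
  tendsto : ∃ l, Tendsto (fun n : ℕ => compensated ρ X φ (closedBall c (n * h))) atTop (𝓝 l)

namespace ConvergesAlong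

variable {F : Type*} [NormedAddCommGroup F] [NormedSpace ℝ F] {ρ : ℝ} {X : Configuration d}
  {c : EuclideanSpace ℝ (Fin d)} {h : ℝ} {φ ψ : EuclideanSpace ℝ (Fin d) → F}

theorem integrableOn (hφ : ConvergesAlong ρ X c h φ) (r : ℝ) : IntegrableOn φ (closedBall c r) := by
  obtain ⟨K, hK⟩ := hφ.bounded
  exact Measure.integrableOn_of_bounded isBounded_closedBall.measure_lt_top.ne
    hφ.stronglyMeasurable.aestronglyMeasurable (ae_of_all _ hK)

theorem add (hφ : ConvergesAlong ρ X c h φ) (hψ : ConvergesAlong ρ X c h ψ) :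
    ConvergesAlong ρ X c h (φ + ψ) where
  stronglyMeasurable := hφ.stronglyMeasurable.add hψ.stronglyMeasurable
  bounded := by
    obtain ⟨K, hK⟩ := hφ.bounded
    obtain ⟨K', hK'⟩ := hψ.bounded
    exact ⟨K + K', fun z => (norm_add_le _ _).trans (add_le_add (hK z) (hK' z))⟩
  tendsto := by
    obtain ⟨l, hl⟩ := hφ.tendsto
    obtain ⟨l', hl'⟩ := hψ.tendsto
    refine ⟨l + l', (hl.add hl').congr fun n => ?_⟩
    simp only [compensated, Pi.add_apply]
    rw [integral_add (X.integrableOn_countMeasure _ measurableSet_closedBall isBounded_closedBall)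
      (X.integrableOn_countMeasure _ measurableSet_closedBall isBounded_closedBall),
      integral_add (hφ.integrableOn _) (hψ.integrableOn _), smul_add]
    abel

theorem smul (a : ℝ) (hφ : ConvergesAlong ρ X c h φ) : ConvergesAlong ρ X c h (a • φ) where
  stronglyMeasurable := hφ.stronglyMeasurable.const_smul a
  bounded := by
    obtain ⟨K, hK⟩ := hφ.bounded
    refine ⟨|a| * K, fun z => ?_⟩
    rw [Pi.smul_apply, norm_smul, Real.norm_eq_abs]
    exact mul_le_mul_of_nonneg_left (hK z) (abs_nonneg a)
  tendsto := by
    obtain ⟨l, hl⟩ := hφ.tendsto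
    refine ⟨a • l, (hl.const_smul a).congr fun n => ?_⟩
    simp only [compensated, Pi.smul_apply, integral_smul, smul_sub, smul_comm a ρ]

theorem zero : ConvergesAlong ρ X c h (0 : EuclideanSpace ℝ (Fin d) → F) where
  stronglyMeasurable := stronglyMeasurable_zero
  bounded := ⟨0, by simp⟩
  tendsto := ⟨0, by simp [compensated]⟩

theorem sum {ι : Type*} (s : Finset ι) {φ : ι → EuclideanSpace ℝ (Fin d) → F}
    (hφ : ∀ i ∈ s, ConvergesAlong ρ X c h (φ i)) : ConvergesAlong ρ X c h (∑ i ∈ s, φ i) :=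
  Finset.sum_induction _ _ (fun _ _ => add) zero hφ

theorem sub (hφ : ConvergesAlong ρ X c h φ) (hψ : ConvergesAlong ρ X c h ψ) :
    ConvergesAlong ρ X c h (φ - ψ) := by
  have := hφ.add (hψ.smul (-1))
  rwa [neg_one_smul, ← sub_eq_add_neg] at this

theorem of_integrable (hm : StronglyMeasurable φ) (hb : ∃ K : ℝ, ∀ z, ‖φ z‖ ≤ K)
    (h0 : 0 ≤ h) (hX : Integrable φ X.countMeasure) (hi : Integrable φ) :
    ConvergesAlong ρ X c h φ where
  stronglyMeasurable := hm
  bounded := hb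
  tendsto := by
    have hmono : Monotone fun n : ℕ => closedBall c (n * h) := fun m n hmn =>
      closedBall_subset_closedBall (mul_le_mul_of_nonneg_right (by exact_mod_cast hmn) h0)
    exact ⟨_, (tendsto_setIntegral_of_monotone (fun n => measurableSet_closedBall) hmono
      hX.integrableOn).sub ((tendsto_setIntegral_of_monotone (fun n => measurableSet_closedBall) hmono
      hi.integrableOn).const_smul ρ)⟩

end ConvergesAlong

theorem integrable_comp_sub_of_decay {ν : Measure (EuclideanSpace ℝ (Fin d))} {n : ℕ}
    (hν : Integrable (decay n) ν) (c : EuclideanSpace ℝ (Fin d)) :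
    Integrable (fun z => decay n (c - z)) ν := by
  refine (hν.const_mul ((1 + ‖c‖) ^ n)).mono' ?_ (ae_of_all _ fun z => ?_)
  · exact ((measurable_decay n).comp (by fun_prop)).aestronglyMeasurable
  · rw [Real.norm_of_nonneg (decay_nonneg _ _)]
    have := decay_add_le n (-z) c
    rwa [neg_add_eq_sub, show decay n (-z) = decay n z by simp [decay]] at this

/-- The kernel based at `x` is the affine interpolation of those based at `c` and at `c + e_i`, plus
`affineError`, which is integrable for both the configuration and the Lebesgue measure. Thus
finitely many convergences at `c` serve for all `x` near `c`, and a countable set of centres will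
cover the whole space. -/
theorem ConvergesAlong.coulombTail_near [NeZero d] {ρ : ℝ} {X : Configuration d}
    {c x : EuclideanSpace ℝ (Fin d)} {h : ℝ} (h0 : 0 ≤ h) (hx : ‖x - c‖ ≤ 1)
    (hX : Integrable (decay (d + 1)) X.countMeasure)
    (hc : ConvergesAlong ρ X c h fun z => coulombTail (c - z))
    (hci : ∀ i, ConvergesAlong ρ X c h fun z =>
      coulombTail (c + EuclideanSpace.single i 1 - z)) :
    ConvergesAlong ρ X c h fun z => coulombTail (x - z) := by
  obtain ⟨C, hC0, hC⟩ := exists_norm_affineError_le (d := d)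
  have hEm : StronglyMeasurable fun z => affineError (x - c) (c - z) := by
    unfold affineError
    have := measurable_coulombTail (d := d)
    exact Measurable.stronglyMeasurable (by fun_prop)
  have hE {ν : Measure (EuclideanSpace ℝ (Fin d))} (hν : Integrable (decay (d + 1)) ν) :
      Integrable (fun z => affineError (x - c) (c - z)) ν :=
    ((integrable_comp_sub_of_decay hν c).const_mul C).mono' hEm.aestronglyMeasurable
      (ae_of_all _ fun z => hC _ _ hx)
  have hEc : ConvergesAlong ρ X c h fun z => affineError (x - c) (c - z) := by
    refine .of_integrable hEm ⟨C, fun z => (hC _ _ hx).trans ?_⟩ h0 (hE hX)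
      (hE (integrable_decay (by simp)))
    exact mul_le_of_le_one_right hC0 (decay_le_one _ _)
  have hs := (hEc.add hc).add (.sum Finset.univ fun i _ => ((hci i).sub hc).smul ((x - c) i))
  convert hs using 1
  ext1 z
  have e1 (i) : c - z + EuclideanSpace.single i 1 = c + EuclideanSpace.single i 1 - z := by abel
  simp only [affineError, Pi.add_apply, Finset.sum_apply, Pi.smul_apply, Pi.sub_apply, e1,
    show c - z + (x - c) = x - z by abel]
  abel

/-- Both `B` and `B'` lie between `A` and `A'`, so each differs from `A` by a part of `A' \ A`. This
serves to exchange balls around `x` for balls around `c`. -/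
theorem norm_setIntegral_sub_setIntegral_le {ν : Measure (EuclideanSpace ℝ (Fin d))} {F : Type*}
    [NormedAddCommGroup F] [NormedSpace ℝ F] {φ : EuclideanSpace ℝ (Fin d) → F}
    {w : EuclideanSpace ℝ (Fin d) → ℝ} (hφw : ∀ z, ‖φ z‖ ≤ w z)
    {A A' B B' : Set (EuclideanSpace ℝ (Fin d))} (hA : MeasurableSet A)
    (hφ : IntegrableOn φ A' ν) (hw : IntegrableOn w A' ν)
    (hAB : A ⊆ B) (hBA : B ⊆ A') (hAB' : A ⊆ B') (hBA' : B' ⊆ A') :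
    ‖∫ z in B, φ z ∂ν - ∫ z in B', φ z ∂ν‖ ≤ 2 * ∫ z in A' \ A, w z ∂ν := by
  have key {B : Set (EuclideanSpace ℝ (Fin d))} (hAB : A ⊆ B) (hBA : B ⊆ A') :
      ‖∫ z in B, φ z ∂ν - ∫ z in A, φ z ∂ν‖ ≤ ∫ z in A' \ A, w z ∂ν := by
    rw [← setIntegral_sdiff hA (hφ.mono_set hBA) hAB]
    calc ‖∫ z in B \ A, φ z ∂ν‖ ≤ ∫ z in B \ A, w z ∂ν :=
          norm_integral_le_of_norm_le (hw.mono_set (sdiff_subset.trans hBA)) (ae_of_all _ hφw)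
      _ ≤ ∫ z in A' \ A, w z ∂ν :=
          setIntegral_mono_set (hw.mono_set sdiff_subset)
            (ae_of_all _ fun z => (norm_nonneg _).trans (hφw z))
            (LE.le.eventuallyLE (sdiff_subset_sdiff_left hBA))
  calc _ = ‖(∫ z in B, φ z ∂ν - ∫ z in A, φ z ∂ν) - (∫ z in B', φ z ∂ν - ∫ z in A, φ z ∂ν)‖ := by
        congr 1; abel
    _ ≤ _ := (norm_sub_le _ _).trans (by linarith [key hAB hBA, key hAB' hBA'])

/-- By oddness of the kernel. This is why balls centred at `x` need no compensation. -/
theorem setIntegral_coulombTail_closedBall (x : EuclideanSpace ℝ (Fin d)) (r : ℝ) :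
    ∫ z in closedBall x r, coulombTail (x - z) = 0 := by
  let g := (closedBall (0 : EuclideanSpace ℝ (Fin d)) r).indicator coulombTail
  have h1 : ∫ z in closedBall x r, coulombTail (x - z) = ∫ z, g (x - z) := by
    rw [← integral_indicator measurableSet_closedBall]
    refine integral_congr_ae (ae_of_all _ fun z => ?_)
    simp only [g, indicator, mem_closedBall, dist_eq_norm, norm_sub_rev z x, sub_zero]
  have h2 : ∫ z, g (-z) = -∫ z, g z := by
    rw [← integral_neg]
    refine integral_congr_ae (ae_of_all _ fun z => ?_)
    by_cases hz : ‖z‖ ≤ r <;> simp [g, hz, coulombTail_neg]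
  rw [integral_neg_eq_self] at h2
  rw [h1, integral_sub_left_eq_self]
  have h3 : (2 : ℝ) • ∫ z, g z = 0 := by
    rw [two_smul]
    nth_rewrite 1 [h2]
    exact neg_add_cancel _
  exact (smul_eq_zero.1 h3).resolve_left two_ne_zero

theorem norm_coulombTail_sub_le [NeZero d] {c x : EuclideanSpace ℝ (Fin d)} (hx : ‖x - c‖ ≤ 1)
    (z : EuclideanSpace ℝ (Fin d)) :
    ‖coulombTail (x - z)‖ ≤ 4 ^ (d - 1) * decay (d - 1) (z - c) := by
  refine (norm_coulombTail_le _).trans ?_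
  have h1 : decay (d - 1) (x - z) = decay (d - 1) ((z - c) + (c - x)) := by
    rw [sub_add_sub_cancel, decay, decay, norm_sub_rev]
  have h2 := decay_add_le (d - 1) (z - c) (c - x)
  rw [← h1, norm_sub_rev c x] at h2
  have h3 : (1 + ‖x - c‖) ^ (d - 1) ≤ 2 ^ (d - 1) := by
    gcongr; linarith
  calc 2 ^ (d - 1) * decay (d - 1) (x - z)
      ≤ 2 ^ (d - 1) * (2 ^ (d - 1) * decay (d - 1) (z - c)) := by
        gcongr
        refine h2.trans ?_
        gcongr
        exact decay_nonneg _ _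
    _ = 4 ^ (d - 1) * decay (d - 1) (z - c) := by
        rw [← mul_assoc, ← mul_pow]; norm_num

/-- The truncated force at `x` over large balls oscillates at most proportionally to the mesh `h`
along which compensated sums around a nearby point are known to converge. -/
theorem exists_dist_setIntegral_coulombTail_le [NeZero d] {ρ : ℝ} (hρ : 0 ≤ ρ) :
    ∃ C, 0 ≤ C ∧ ∀ (X : Configuration d) (c x : EuclideanSpace ℝ (Fin d)) (h : ℝ), 0 < h → h ≤ 1 →
      ‖x - c‖ ≤ h → ConvergesAlong ρ X c h (fun z => decay (d - 1) (z - c)) →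
      ConvergesAlong ρ X c h (fun z => coulombTail (x - z)) →
      ∃ R₀, ∀ R ≥ R₀, ∀ R' ≥ R₀,
        dist (∫ z in closedBall x R, coulombTail (x - z) ∂X.countMeasure)
          (∫ z in closedBall x R', coulombTail (x - z) ∂X.countMeasure) ≤ C * h := by
  obtain ⟨C, hC0, hC⟩ := exists_setIntegral_decay_shell_le (d := d)
  set K : ℝ := 4 ^ (d - 1) with hK
  have hK0 : 0 ≤ K := by positivity
  -- Each of the two integrals will be within `B h + h / 2` of the common limit `lφ`, where `B` is
  -- the factor inside the outer parentheses.
  refine ⟨2 * (2 * K * (1 + ρ * (C * 3)) + ρ * (2 * K * (C * 3))) + 1, by positivity,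
    fun X c x h h0 h1 hxc hw hφ => ?_⟩
  set φ : EuclideanSpace ℝ (Fin d) → EuclideanSpace ℝ (Fin d) := fun z => coulombTail (x - z) with hφdef
  set w : EuclideanSpace ℝ (Fin d) → ℝ := fun z => decay (d - 1) (z - c) with hwdef
  have hφw (z) : ‖φ z‖ ≤ K * w z := norm_coulombTail_sub_le (hxc.trans h1) z
  obtain ⟨lw, hlw⟩ := hw.tendsto
  obtain ⟨lφ, hlφ⟩ := hφ.tendsto
  have hwX (n : ℕ) : IntegrableOn w (closedBall c (n * h)) X.countMeasure :=
    X.integrableOn_countMeasure _ measurableSet_closedBall isBounded_closedBall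
  have hsub (n : ℕ) : closedBall c (n * h) ⊆ closedBall c ((n + 3 : ℕ) * h) :=
    closedBall_subset_closedBall (by gcongr; simp)
  have hshell (n : ℕ) : ∫ z in closedBall c ((n + 3 : ℕ) * h) \ closedBall c (n * h), w z ≤
      C * 3 * h := by
    have := hC c (n * h) (3 * h) (by positivity) (by positivity) (by linarith)
    rw [show (n : ℝ) * h + 3 * h = (n + 3 : ℕ) * h by push_cast; ring] at this
    linarith
  have hshellX : ∀ᶠ n : ℕ in atTop,
      ∫ z in closedBall c ((n + 3 : ℕ) * h) \ closedBall c (n * h), w z ∂X.countMeasure ≤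
        (1 + ρ * (C * 3)) * h := by
    -- Convergence of the compensated weights makes their increments over three steps tend to `0`,
    -- hence eventually smaller than `h`. The weight of the shell for the configuration is then at
    -- most `h` more than its mean, which is at most `ρ * (C * 3) * h`.
    have ht : Tendsto (fun n : ℕ => compensated ρ X w (closedBall c ((n + 3 : ℕ) * h)) -
        compensated ρ X w (closedBall c (n * h))) atTop (𝓝 0) := by
      have := (hlw.comp (tendsto_add_atTop_nat 3)).sub hlw
      rwa [sub_self] at this
    filter_upwards [ht.eventually (gt_mem_nhds h0)] with n hn
    have e1 := setIntegral_sdiff measurableSet_closedBall (hwX (n + 3)) (hsub n)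
    have e2 := setIntegral_sdiff measurableSet_closedBall (hw.integrableOn _) (hsub n)
    simp only [compensated, smul_eq_mul] at hn
    rw [e1]
    have := mul_le_mul_of_nonneg_left (e2 ▸ hshell n) hρ
    linarith
  have hcauchy : ∀ᶠ n : ℕ in atTop, dist (compensated ρ X φ (closedBall c (n * h))) lφ < h / 2 :=
    (Metric.tendsto_nhds.1 hlφ) _ (half_pos h0)
  obtain ⟨N, hN⟩ := eventually_atTop.1 (hshellX.and hcauchy)
  set B := 2 * K * (1 + ρ * (C * 3)) + ρ * (2 * K * (C * 3)) with hB
  suffices H : ∀ R ≥ (N + 1 : ℕ) * h, dist (∫ z in closedBall x R, φ z ∂X.countMeasure) lφ ≤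
      B * h + h / 2 by
    refine ⟨(N + 1 : ℕ) * h, fun R hR R' hR' => ?_⟩
    have := dist_triangle_right (∫ z in closedBall x R, φ z ∂X.countMeasure)
      (∫ z in closedBall x R', φ z ∂X.countMeasure) lφ
    linarith [H R hR, H R' hR']
  intro R hR
  have hRn : N + 1 ≤ ⌊R / h⌋₊ := Nat.le_floor ((le_div_iff₀ h0).2 hR)
  -- With this `k`, `(k + 1) h ≤ R ≤ (k + 2) h`. As `‖x - c‖ ≤ h`, the ball of radius `R` around `x`
  -- lies between those of radii `k h` and `(k + 3) h` around `c`.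
  obtain ⟨k, hk⟩ : ∃ k, ⌊R / h⌋₊ = k + 1 := ⟨⌊R / h⌋₊ - 1, by omega⟩
  have hkN : N ≤ k := by omega
  have hR0 : 0 ≤ R / h := div_nonneg ((by positivity : (0 : ℝ) ≤ (N + 1 : ℕ) * h).trans hR) h0.le
  have hlow : (k + 1 : ℕ) * h ≤ R := by
    rw [← le_div_iff₀ h0, ← hk]; exact Nat.floor_le hR0
  have hupp : R ≤ (k + 2 : ℕ) * h := by
    rw [← div_le_iff₀ h0]
    have := (Nat.lt_floor_add_one (R / h)).le
    rw [hk] at this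
    push_cast at this ⊢
    linarith
  have hball (r : ℝ) (hr1 : (k + 1 : ℕ) * h ≤ r) (hr2 : r ≤ (k + 2 : ℕ) * h) :
      closedBall c (k * h) ⊆ closedBall x r ∧ closedBall x r ⊆ closedBall c ((k + 3 : ℕ) * h) := by
    push_cast at hr1 hr2 ⊢
    constructor
    · refine closedBall_subset_closedBall' ?_
      rw [dist_comm, dist_eq_norm]
      linarith
    · refine closedBall_subset_closedBall' ?_
      rw [dist_eq_norm]
      linarith
  have hmid : closedBall c (k * h) ⊆ closedBall c ((k + 1 : ℕ) * h) ∧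
      closedBall c ((k + 1 : ℕ) * h) ⊆ closedBall c ((k + 3 : ℕ) * h) :=
    ⟨closedBall_subset_closedBall (by gcongr; simp), closedBall_subset_closedBall (by gcongr; simp)⟩
  have d1 : ‖∫ z in closedBall x R, φ z ∂X.countMeasure -
      ∫ z in closedBall c ((k + 1 : ℕ) * h), φ z ∂X.countMeasure‖ ≤
        2 * K * (1 + ρ * (C * 3)) * h := by
    refine (norm_setIntegral_sub_setIntegral_le hφw measurableSet_closedBall
      (X.integrableOn_countMeasure _ measurableSet_closedBall isBounded_closedBall)
      ((hwX (k + 3)).const_mul K) (hball R hlow hupp).1 (hball R hlow hupp).2 hmid.1 hmid.2).trans ?_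
    rw [integral_const_mul]
    have := mul_le_mul_of_nonneg_left (hN k hkN).1 (by positivity : 0 ≤ 2 * K)
    linarith
  -- Compare with the ball of the same radius around `x`, over which the integral vanishes; only the
  -- weight of a shell remains.
  have d2 : ‖∫ z in closedBall c ((k + 1 : ℕ) * h), φ z‖ ≤ 2 * K * (C * 3) * h := by
    have hb := hball ((k + 1 : ℕ) * h) le_rfl (by gcongr; simp)
    have := norm_setIntegral_sub_setIntegral_le (ν := volume) hφw measurableSet_closedBall
      (hφ.integrableOn _) ((hw.integrableOn ((k + 3 : ℕ) * h)).const_mul K) hmid.1 hmid.2 hb.1 hb.2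
    rw [setIntegral_coulombTail_closedBall, sub_zero, integral_const_mul] at this
    have h3 := mul_le_mul_of_nonneg_left (hshell k) (by positivity : 0 ≤ 2 * K)
    linarith
  have d3 := (hN (k + 1) (by omega)).2
  rw [dist_eq_norm] at d3 ⊢
  calc ‖∫ z in closedBall x R, φ z ∂X.countMeasure - lφ‖
      = ‖(∫ z in closedBall x R, φ z ∂X.countMeasure -
          ∫ z in closedBall c ((k + 1 : ℕ) * h), φ z ∂X.countMeasure) +
        ρ • (∫ z in closedBall c ((k + 1 : ℕ) * h), φ z) +
        (compensated ρ X φ (closedBall c ((k + 1 : ℕ) * h)) - lφ)‖ := by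
        congr 1
        simp only [compensated]
        abel
    _ ≤ 2 * K * (1 + ρ * (C * 3)) * h + ρ * (2 * K * (C * 3) * h) + h / 2 := by
        refine (norm_add₃_le).trans (add_le_add (add_le_add d1 ?_) d3.le)
        rw [norm_smul, Real.norm_of_nonneg hρ]
        gcongr
    _ = B * h + h / 2 := by rw [hB]; ring

/-- The contribution of the unit ball does not depend on `R`, so only the tail matters for the
convergence. -/
theorem partialForce_eq_add (X : Configuration d) (x : EuclideanSpace ℝ (Fin d)) {R : ℝ}
    (hR : 1 ≤ R) : partialForce X x R =
      ∫ z in closedBall x R, coulombTail (x - z) ∂X.countMeasure +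
        ∫ z in ball x 1, coulomb (x - z) ∂X.countMeasure := by
  have hsub : ball x 1 ⊆ closedBall x R := ball_subset_closedBall.trans (closedBall_subset_closedBall hR)
  have hi := X.integrableOn_countMeasure (fun z => coulomb (x - z)) (B := closedBall x R)
    measurableSet_closedBall isBounded_closedBall
  rw [partialForce_eq_setIntegral]
  refine eq_add_of_sub_eq ((setIntegral_sdiff measurableSet_ball hi hsub).symm.trans ?_)
  rw [← inter_eq_self_of_subset_right (sdiff_subset (s := closedBall x R) (t := ball x 1)),
    ← setIntegral_indicator (measurableSet_closedBall.diff measurableSet_ball)]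
  refine setIntegral_congr_fun measurableSet_closedBall fun z hz => ?_
  by_cases h : ‖x - z‖ < 1
  · have hz' : z ∈ ball x 1 := by rwa [mem_ball, dist_comm, dist_eq_norm]
    simp [indicator, coulombTail, h, hz']
  · have hz' : z ∉ ball x 1 := by rwa [mem_ball, dist_comm, dist_eq_norm]
    have h2 : z ∈ closedBall x R \ ball x 1 := ⟨hz, hz'⟩
    rw [indicator_of_mem h2, coulombTail_of_one_le (not_lt.1 h)]

/-- A criterion for a configuration to be valid. -/
theorem isValid_of_convergesAlong [NeZero d] {ρ : ℝ} (hρ : 0 ≤ ρ) {X : Configuration d}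
    (hX : Integrable (decay (d + 1)) X.countMeasure) {S : Set (EuclideanSpace ℝ (Fin d))}
    (hS : Dense S) (h : ∀ c ∈ S, ∀ m : ℕ,
      ConvergesAlong ρ X c (1 / (m + 1)) (fun z => decay (d - 1) (z - c)) ∧
      ConvergesAlong ρ X c (1 / (m + 1)) (fun z => coulombTail (c - z)) ∧
      ∀ i, ConvergesAlong ρ X c (1 / (m + 1))
        fun z => coulombTail (c + EuclideanSpace.single i 1 - z)) : IsValid X := by
  intro x
  obtain ⟨C, hC0, hC⟩ := exists_dist_setIntegral_coulombTail_le (d := d) hρ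
  have hcauchy : CauchySeq fun R : ℝ =>
      ∫ z in closedBall x R, coulombTail (x - z) ∂X.countMeasure := by
    rw [Metric.cauchySeq_iff]
    intro η hη
    obtain ⟨m, hm⟩ := exists_nat_one_div_lt (div_pos hη (by positivity : 0 < C + 1))
    have hm0 : (0 : ℝ) < 1 / (m + 1) := Nat.one_div_pos_of_nat
    have hm1 : (1 : ℝ) / (m + 1) ≤ 1 := by
      rw [div_le_one (by positivity)]; linarith [Nat.cast_nonneg (α := ℝ) m]
    obtain ⟨c, hcS, hc⟩ := hS.exists_dist_lt x hm0
    rw [dist_eq_norm] at hc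
    obtain ⟨h1, h2, h3⟩ := h c hcS m
    obtain ⟨R₀, hR₀⟩ := hC X c x _ hm0 hm1 hc.le h1
      (.coulombTail_near hm0.le (hc.le.trans hm1) hX h2 h3)
    refine ⟨R₀, fun R hR R' hR' => (hR₀ R hR R' hR').trans_lt ?_⟩
    rw [lt_div_iff₀ (by positivity)] at hm
    nlinarith
  obtain ⟨l, hl⟩ := cauchySeq_tendsto_of_complete hcauchy
  refine ⟨_, (hl.add_const (∫ z in ball x 1, coulomb (x - z) ∂X.countMeasure)).congr' ?_⟩
  filter_upwards [eventually_ge_atTop 1] with R hR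
  rw [partialForce_eq_add X x hR]

end RepelledPoisson

/-! ### Almost sure validity of the Poisson process -/

namespace RepelledPoisson

open Set Metric

variable {d : ℕ}

namespace IsHomogeneousPoisson

variable {L : Measure (Configuration d)} [IsProbabilityMeasure L] {ρ : ℝ≥0} [NeZero d]

theorem ae_convergesAlong_real (hd : 3 ≤ d) (hL : IsHomogeneousPoisson id L ρ)
    {g : EuclideanSpace ℝ (Fin d) → ℝ} (hm : Measurable g) {K : ℝ} {c : EuclideanSpace ℝ (Fin d)}
    (hK : ∀ z, ‖g z‖ ≤ K * decay (d - 1) (z - c)) {h : ℝ} (h0 : 0 ≤ h) :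
    ∀ᵐ X ∂L, ConvergesAlong ρ X c h g := by
  have hK0 : 0 ≤ K := by
    have := (norm_nonneg _).trans (hK c)
    simpa [decay] using this
  have hgK (z) : ‖g z‖ ≤ K :=
    (hK z).trans (mul_le_of_le_one_right hK0 (decay_le_one _ _))
  have hg : Integrable fun z => g z ^ 2 := by
    -- The square decays with exponent `2(d - 1)`, which exceeds `d` exactly when `d ≥ 3`.
    have h1 : Integrable fun z => K ^ 2 * decay ((d - 1) * 2) (z - c) :=
      ((integrable_decay (d := d) (by omega)).comp_sub_right c).const_mul _
    refine h1.mono' (by fun_prop) (ae_of_all _ fun z => ?_)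
    rw [norm_pow]
    calc ‖g z‖ ^ 2 ≤ (K * decay (d - 1) (z - c)) ^ 2 := by gcongr; exact hK z
      _ = K ^ 2 * decay ((d - 1) * 2) (z - c) := by
        rw [mul_pow, decay, decay, pow_mul, inv_pow]
  have hmono : Monotone fun n : ℕ => closedBall c (n * h) := fun m n hmn =>
    closedBall_subset_closedBall (mul_le_mul_of_nonneg_right (by exact_mod_cast hmn) h0)
  filter_upwards [hL.ae_exists_tendsto_compensated hm hgK hg (fun n => measurableSet_closedBall)
    (fun n => isBounded_closedBall) hmono] with X hX
  refine ⟨hm.stronglyMeasurable, ⟨K, hgK⟩, ?_⟩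
  simp_rw [pointSum, integral_indicator measurableSet_closedBall] at hX
  exact hX

theorem ae_convergesAlong (hd : 3 ≤ d) (hL : IsHomogeneousPoisson id L ρ)
    {φ : EuclideanSpace ℝ (Fin d) → EuclideanSpace ℝ (Fin d)} (hm : Measurable φ) {K : ℝ}
    {c : EuclideanSpace ℝ (Fin d)} (hK : ∀ z, ‖φ z‖ ≤ K * decay (d - 1) (z - c)) {h : ℝ}
    (h0 : 0 ≤ h) : ∀ᵐ X ∂L, ConvergesAlong ρ X c h φ := by
  have hK0 : 0 ≤ K := by
    have := (norm_nonneg _).trans (hK c)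
    simpa [decay] using this
  have hφK (z) : ‖φ z‖ ≤ K :=
    (hK z).trans (mul_le_of_le_one_right hK0 (decay_le_one _ _))
  have hcoord (i : Fin d) : ∀ᵐ X ∂L, ConvergesAlong ρ X c h fun z => φ z i :=
    hL.ae_convergesAlong_real hd (by fun_prop) (fun z => (PiLp.norm_apply_le _ i).trans (hK z)) h0
  filter_upwards [ae_all_iff.2 hcoord] with X hX
  refine ⟨hm.stronglyMeasurable, ⟨K, hφK⟩, ?_⟩
  choose l hl using fun i => (hX i).tendsto
  refine ⟨WithLp.toLp 2 l, ?_⟩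
  have h1 (n : ℕ) : compensated ρ X φ (closedBall c (n * h)) =
      WithLp.toLp 2 fun i => compensated ρ X (fun z => φ z i) (closedBall c (n * h)) := by
    ext i
    have e1 : IntegrableOn φ (closedBall c (n * h)) X.countMeasure :=
      X.integrableOn_countMeasure _ measurableSet_closedBall isBounded_closedBall
    have e2 : IntegrableOn φ (closedBall c (n * h)) :=
      Measure.integrableOn_of_bounded isBounded_closedBall.measure_lt_top.ne
        hm.aestronglyMeasurable (ae_of_all _ hφK)
    have f1 : ∫ z in closedBall c (n * h), φ z i ∂X.countMeasure = _ := (EuclideanSpace.proj (𝕜 := ℝ) i).integral_comp_comm e1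
    have f2 : ∫ z in closedBall c (n * h), φ z i = _ := (EuclideanSpace.proj (𝕜 := ℝ) i).integral_comp_comm e2
    simp only [compensated, PiLp.sub_apply, PiLp.smul_apply, f1, f2]
    rfl
  simp_rw [h1]
  exact ((PiLp.continuous_toLp 2 _).tendsto l).comp (tendsto_pi_nhds.2 hl)

/-- By Mecke, the mean of the sum of `‖g‖` over the points is `ρ ∫ ‖g‖`, which is finite. -/
theorem ae_integrable_countMeasure (hL : IsHomogeneousPoisson id L ρ)
    {g : EuclideanSpace ℝ (Fin d) → ℝ} (hm : Measurable g) (hg : Integrable g) :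
    ∀ᵐ X : Configuration d ∂L, Integrable g X.countMeasure := by
  have h := hL.mecke (G := fun _ z => ‖g z‖ₑ) (by fun_prop)
  have hfin : ∫⁻ X, ∫⁻ z, ‖g z‖ₑ ∂X.countMeasure ∂L ≠ ∞ := by
    rw [h, lintegral_const, measure_univ, mul_one]
    exact ENNReal.mul_ne_top ENNReal.coe_ne_top hg.2.ne
  have hmeas : Measurable fun X : Configuration d => ∫⁻ z, ‖g z‖ₑ ∂X.countMeasure :=
    Measurable.lintegral_kernel (κ := pointKernel d) (by fun_prop)
  filter_upwards [ae_lt_top hmeas hfin] with X hX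
  exact ⟨hm.aestronglyMeasurable, hX⟩

/-- The criterion asks for countably many almost sure events, indexed by a dense sequence of
centres, the meshes `1 / (m + 1)` and the basis vectors. -/
theorem ae_isValid (hd : 3 ≤ d) (hL : IsHomogeneousPoisson id L ρ) : ∀ᵐ X ∂L, IsValid X := by
  have hw (c : EuclideanSpace ℝ (Fin d)) (m : ℕ) : ∀ᵐ X ∂L,
      ConvergesAlong ρ X c (1 / (m + 1)) fun z => decay (d - 1) (z - c) :=
    hL.ae_convergesAlong_real hd ((measurable_decay _).comp (by fun_prop)) (K := 1)
      (fun z => by rw [one_mul]; exact (Real.norm_of_nonneg (decay_nonneg _ _)).le) (by positivity)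
  have hf (c x : EuclideanSpace ℝ (Fin d)) (hx : ‖x - c‖ ≤ 1) (m : ℕ) : ∀ᵐ X ∂L,
      ConvergesAlong ρ X c (1 / (m + 1)) fun z => coulombTail (x - z) :=
    hL.ae_convergesAlong hd (measurable_coulombTail.comp (by fun_prop))
      (norm_coulombTail_sub_le hx) (by positivity)
  have h0 := hL.ae_integrable_countMeasure (measurable_decay (d + 1)) (integrable_decay (by simp))
  have h1 := ae_all_iff.2 fun n : ℕ => ae_all_iff.2 fun m : ℕ =>
    hw (TopologicalSpace.denseSeq _ n) m
  have h2 := ae_all_iff.2 fun n : ℕ => ae_all_iff.2 fun m : ℕ =>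
    hf (TopologicalSpace.denseSeq _ n) (TopologicalSpace.denseSeq _ n) (by simp) m
  have h3 := ae_all_iff.2 fun n : ℕ => ae_all_iff.2 fun m : ℕ => ae_all_iff.2 fun i : Fin d =>
    hf (TopologicalSpace.denseSeq _ n) (TopologicalSpace.denseSeq _ n + EuclideanSpace.single i 1)
      (by simp) m
  filter_upwards [h0, h1, h2, h3] with X h0 h1 h2 h3
  refine isValid_of_convergesAlong ρ.2 h0 (TopologicalSpace.denseRange_denseSeq _) ?_
  rintro _ ⟨n, rfl⟩ m
  exact ⟨h1 n m, h2 n m, h3 n m⟩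

end IsHomogeneousPoisson

end RepelledPoisson

/-! ### Absence of collisions -/

namespace RepelledPoisson

open Set Metric
open _root_.RepelledPoisson.Configuration

variable {d : ℕ}

/-- The limit of the partial forces over the balls with integer radius. -/
noncomputable def natForce (X : Configuration d) (x : EuclideanSpace ℝ (Fin d)) :
    EuclideanSpace ℝ (Fin d) :=
  limUnder atTop fun n : ℕ => partialForce X x n

theorem IsValid.tendsto_force {X : Configuration d} (hX : IsValid X)
    (x : EuclideanSpace ℝ (Fin d)) : Tendsto (partialForce X x) atTop (𝓝 (force X x)) :=
  tendsto_nhds_limUnder (hX x)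

theorem IsValid.natForce_eq {X : Configuration d} (hX : IsValid X)
    (x : EuclideanSpace ℝ (Fin d)) : natForce X x = force X x :=
  ((hX.tendsto_force x).comp tendsto_natCast_atTop_atTop).limUnder_eq

theorem measurable_partialForce (R : ℝ) :
    Measurable fun p : Configuration d × EuclideanSpace ℝ (Fin d) => partialForce p.1 p.2 R := by
  classical
  have hm : Measurable fun q : (Configuration d × EuclideanSpace ℝ (Fin d)) ×
      EuclideanSpace ℝ (Fin d) => if dist q.2 q.1.2 ≤ R then coulomb (q.1.2 - q.2) else 0 :=
    Measurable.ite (measurableSet_le (by fun_prop) measurable_const)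
      (measurable_coulomb.comp (by fun_prop)) measurable_const
  have := StronglyMeasurable.integral_kernel_prod_right'
    (κ := (pointKernel d).comap Prod.fst measurable_fst) hm.stronglyMeasurable
  convert! this.measurable using 2 with p
  rw [partialForce_eq_setIntegral, ← integral_indicator measurableSet_closedBall]
  rfl

/-- A limit along a sequence of jointly measurable functions is jointly measurable; this is the
purpose of the integer radii. On valid configurations the result is the true force. -/
theorem measurable_natForce :
    Measurable fun p : Configuration d × EuclideanSpace ℝ (Fin d) => natForce p.1 p.2 :=
  (StronglyMeasurable.limUnder (l := atTop)
    fun n : ℕ => (measurable_partialForce (d := d) n).stronglyMeasurable).measurable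

theorem measurable_natForce_right (X : Configuration d) : Measurable (natForce X) :=
  Measurable.comp (g := fun p : Configuration d × EuclideanSpace ℝ (Fin d) => natForce p.1 p.2)
    measurable_natForce (f := fun x => (X, x)) measurable_prodMk_left

theorem measurable_natForce_left (x : EuclideanSpace ℝ (Fin d)) :
    Measurable fun X : Configuration d => natForce X x :=
  Measurable.comp (g := fun p : Configuration d × EuclideanSpace ℝ (Fin d) => natForce p.1 p.2)
    measurable_natForce (f := fun X => (X, x)) measurable_prodMk_right

theorem partialForce_insert {X : Configuration d} {z : EuclideanSpace ℝ (Fin d)} (hz : z ∉ X)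
    (x : EuclideanSpace ℝ (Fin d)) {R : ℝ} (hR : dist z x ≤ R) :
    partialForce (insert z X) x R = coulomb (x - z) + partialForce X x R := by
  have h := (insert z X : Configuration d).integrableOn_countMeasure (fun z => coulomb (x - z))
    (B := closedBall x R) measurableSet_closedBall isBounded_closedBall
  rw [partialForce_eq_setIntegral, partialForce_eq_setIntegral]
  rw [countMeasure_insert hz, IntegrableOn, Measure.restrict_add] at h
  rw [countMeasure_insert hz, Measure.restrict_add,
    integral_add_measure (h.mono_measure (Measure.le_add_right le_rfl))
      (h.mono_measure (Measure.le_add_left le_rfl)),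
    ← integral_indicator measurableSet_closedBall, integral_dirac, indicator_of_mem (show z ∈ closedBall x R from hR)]

/-- The new point enters every sufficiently large ball around `x`. For `x = z` its contribution is
`coulomb 0 = 0`, so an added point feels the force of the original configuration. -/
theorem IsValid.natForce_insert {X : Configuration d} (hX : IsValid X)
    {z : EuclideanSpace ℝ (Fin d)} (hz : z ∉ X) (x : EuclideanSpace ℝ (Fin d)) :
    natForce (insert z X) x = coulomb (x - z) + natForce X x := by
  rw [hX.natForce_eq]
  refine Tendsto.limUnder_eq ?_
  refine (((hX.tendsto_force x).comp tendsto_natCast_atTop_atTop).const_add _).congr' ?_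
  filter_upwards [eventually_ge_atTop ⌈dist z x⌉₊] with n hn
  exact (partialForce_insert hz x ((Nat.le_ceil _).trans (by exact_mod_cast hn))).symm

theorem ae_countMeasure_iff {X : Configuration d} {p : EuclideanSpace ℝ (Fin d) → Prop} :
    (∀ᵐ x ∂X.countMeasure, p x) ↔ ∀ x ∈ X, p x := by
  rw [countMeasure, ae_restrict_iff' X.measurableSet_coe, Measure.ae_count_iff]
  rfl

/-- The level sets of the difference between the forces exerted by a point on two other points
are negligible. -/
theorem volume_coulomb_sub_eq_zero (hd : 3 ≤ d) {x y : EuclideanSpace ℝ (Fin d)} (hxy : x ≠ y)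
    (c : EuclideanSpace ℝ (Fin d)) : volume {z | coulomb (x - z) - coulomb (y - z) = c} = 0 := by
  set v := x - y with hv
  have hv0 : v ≠ 0 := sub_ne_zero.2 hxy
  -- With `α` and `β` the inverse powers of `‖a‖` and `‖a - v‖`, the equation reads `(α - β) a = c -
  -- β v`. Either `a` lies in the span of `v` and `c`, of dimension at most `2 < d`, or `α = β` and
  -- `a` lies on the bisecting hyperplane of `0` and `v`.
  let W : Submodule ℝ (EuclideanSpace ℝ (Fin d)) := Submodule.span ℝ {v, c}
  have hW : volume (W : Set (EuclideanSpace ℝ (Fin d))) = 0 := by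
    refine Measure.addHaar_submodule volume W fun h => ?_
    have h1 : Module.finrank ℝ W ≤ 2 := by
      have := finrank_span_finset_le_card (R := ℝ) ({v, c} : Finset (EuclideanSpace ℝ (Fin d)))
      simp only [Finset.coe_insert, Finset.coe_singleton] at this
      exact this.trans Finset.card_le_two
    rw [h, finrank_top, finrank_euclideanSpace_fin] at h1
    omega
  have hB : volume (AffineSubspace.perpBisector (0 : EuclideanSpace ℝ (Fin d)) v :
      Set (EuclideanSpace ℝ (Fin d))) = 0 := by
    refine Measure.addHaar_affineSubspace volume _ fun h => ?_
    exact hv0 (AffineSubspace.perpBisector_eq_top.1 h).symm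
  have hS : volume {a : EuclideanSpace ℝ (Fin d) | coulomb a - coulomb (a - v) = c} = 0 := by
    refine measure_mono_null (fun a ha => ?_) (measure_union_null hW hB)
    rw [mem_ofPred_eq] at ha
    by_cases h : (‖a‖ ^ d)⁻¹ = (‖a - v‖ ^ d)⁻¹
    · right
      have h1 : ‖a‖ = ‖a - v‖ :=
        (pow_left_inj₀ (norm_nonneg _) (norm_nonneg _) (by omega)).1 (inv_injective h)
      rw [SetLike.mem_coe, AffineSubspace.mem_perpBisector_iff_dist_eq, dist_zero_right,
        dist_eq_norm]
      exact h1
    · left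
      have h1 : ((‖a‖ ^ d)⁻¹ - (‖a - v‖ ^ d)⁻¹) • a = c - (‖a - v‖ ^ d)⁻¹ • v := by
        rw [← ha, coulomb, coulomb, sub_smul, smul_sub]
        abel
      have h2 := sub_ne_zero.2 h
      rw [SetLike.mem_coe, ← W.smul_mem_iff h2, h1]
      exact W.sub_mem (Submodule.subset_span (by simp))
        (W.smul_mem _ (Submodule.subset_span (by simp)))
  have hmp : MeasurePreserving (fun z : EuclideanSpace ℝ (Fin d) => x - z) volume volume :=
    Measure.measurePreserving_sub_left volume x
  have hmeas : MeasurableSet {a : EuclideanSpace ℝ (Fin d) | coulomb a - coulomb (a - v) = c} :=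
    measurableSet_eq_fun (measurable_coulomb.sub (measurable_coulomb.comp (by fun_prop)))
      measurable_const
  have := hmp.measure_preimage hmeas.nullMeasurableSet
  rw [hS] at this
  convert! this using 2
  ext z
  simp only [mem_ofPred_eq, mem_preimage, hv, show x - z - (x - y) = y - z by abel]

/-- The pairs of distinct points which collide. -/
def collisions (ε : ℝ) :
    Set ((Configuration d × EuclideanSpace ℝ (Fin d)) × EuclideanSpace ℝ (Fin d)) :=
  {q | q.2 ≠ q.1.2 ∧ q.1.2 + ε • natForce q.1.1 q.1.2 = q.2 + ε • natForce q.1.1 q.2}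

/-- The pairs of distinct points which collide once the first one is added to the
configuration. -/
def collisionsInsert (ε : ℝ) :
    Set ((Configuration d × EuclideanSpace ℝ (Fin d)) × EuclideanSpace ℝ (Fin d)) :=
  {q | q.2 ≠ q.1.2 ∧ q.1.2 + ε • natForce q.1.1 q.1.2 =
    q.2 + ε • (coulomb (q.2 - q.1.2) + natForce q.1.1 q.2)}

theorem measurable_natForce_fst_snd : Measurable fun q : (Configuration d ×
    EuclideanSpace ℝ (Fin d)) × EuclideanSpace ℝ (Fin d) => natForce q.1.1 q.1.2 :=
  Measurable.comp (g := fun p : Configuration d × EuclideanSpace ℝ (Fin d) => natForce p.1 p.2)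
    (f := fun q : (Configuration d × EuclideanSpace ℝ (Fin d)) × EuclideanSpace ℝ (Fin d) => q.1)
    measurable_natForce measurable_fst

theorem measurable_natForce_fst_fst : Measurable fun q : (Configuration d ×
    EuclideanSpace ℝ (Fin d)) × EuclideanSpace ℝ (Fin d) => natForce q.1.1 q.2 :=
  Measurable.comp (g := fun p : Configuration d × EuclideanSpace ℝ (Fin d) => natForce p.1 p.2)
    (f := fun q : (Configuration d × EuclideanSpace ℝ (Fin d)) × EuclideanSpace ℝ (Fin d) =>
      (q.1.1, q.2))
    measurable_natForce (by fun_prop)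

theorem measurableSet_snd_ne : MeasurableSet {q : (Configuration d × EuclideanSpace ℝ (Fin d)) ×
    EuclideanSpace ℝ (Fin d) | q.2 ≠ q.1.2} :=
  (measurableSet_eq_fun measurable_snd (measurable_snd.comp measurable_fst)).compl

theorem measurableSet_collisions (ε : ℝ) : MeasurableSet (collisions (d := d) ε) :=
  measurableSet_snd_ne.inter (measurableSet_eq_fun
    ((measurable_snd.comp measurable_fst).add (measurable_natForce_fst_snd.const_smul ε))
    (measurable_snd.add (measurable_natForce_fst_fst.const_smul ε)))

theorem measurableSet_collisionsInsert (ε : ℝ) : MeasurableSet (collisionsInsert (d := d) ε) :=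
  measurableSet_snd_ne.inter (measurableSet_eq_fun
    ((measurable_snd.comp measurable_fst).add (measurable_natForce_fst_snd.const_smul ε))
    (measurable_snd.add (((measurable_coulomb.comp
      (measurable_snd.sub (measurable_snd.comp measurable_fst))).add
        measurable_natForce_fst_fst).const_smul ε)))

theorem measurable_countMeasure_section
    {S : Set ((Configuration d × EuclideanSpace ℝ (Fin d)) × EuclideanSpace ℝ (Fin d))}
    (hS : MeasurableSet S) : Measurable fun p : Configuration d × EuclideanSpace ℝ (Fin d) =>
      p.1.countMeasure (Prod.mk p ⁻¹' S) :=
  Kernel.measurable_kernel_prodMk_left (κ := (pointKernel d).comap Prod.fst measurable_fst) hS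

namespace IsHomogeneousPoisson

variable {L : Measure (Configuration d)} {ρ : ℝ≥0}

/-- The probability of having no point at all is at most that of an empty ball of radius `n`, which
tends to `0` because `ρ > 0`. -/
theorem ae_countMeasure_univ_ne_zero [NeZero d] (hρ : 0 < ρ) (hL : IsHomogeneousPoisson id L ρ) :
    ∀ᵐ X : Configuration d ∂L, X.countMeasure univ ≠ 0 := by
  have hle (n : ℕ) : L {X | X.countMeasure univ = 0} ≤ ENNReal.ofReal (Real.exp
      (-(ρ * volume.real (closedBall (0 : EuclideanSpace ℝ (Fin d)) 1) * n))) := by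
    have h1 := hL.measure_count_eq (ι := Unit) (B := fun _ => closedBall 0 n)
      (fun _ => measurableSet_closedBall) (fun _ => isBounded_closedBall)
      (fun i j h => (h rfl).elim) (fun _ => 0)
    have h2 : {X : Configuration d | X.countMeasure univ = 0} ⊆
        {X | ∀ _ : Unit, X.count (closedBall 0 n) = (0 : ℕ)} := by
      intro X hX _
      have : X.countMeasure (closedBall 0 n) = 0 := measure_mono_null (subset_univ _) hX
      rw [countMeasure_apply _ measurableSet_closedBall] at this
      simpa using this
    refine (measure_mono h2).trans (h1.le.trans ?_)
    rw [Finset.univ_unique, Finset.prod_singleton, poissonMeasure_singleton]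
    refine ENNReal.ofReal_le_ofReal ?_
    simp only [pow_zero, mul_one, Nat.factorial_zero, Nat.cast_one, div_one]
    refine Real.exp_le_exp.2 (neg_le_neg ?_)
    have h3 : (volume (closedBall (0 : EuclideanSpace ℝ (Fin d)) n)).toReal =
        n ^ d * volume.real (closedBall (0 : EuclideanSpace ℝ (Fin d)) 1) := by
      rw [Measure.addHaar_closedBall' _ _ (by positivity), ENNReal.toReal_mul,
        ENNReal.toReal_ofReal (by positivity), finrank_euclideanSpace_fin]
      rfl
    have h4 : (n : ℝ) ≤ n ^ d := by
      exact_mod_cast Nat.le_self_pow (NeZero.ne d) n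
    rw [NNReal.coe_mul, ENNReal.coe_toNNReal_eq_toReal, h3, mul_assoc,
      mul_comm ((n : ℝ) ^ d)]
    gcongr
  rw [ae_iff]
  simp only [not_not]
  have h1 : 0 < (ρ : ℝ) * volume.real (closedBall (0 : EuclideanSpace ℝ (Fin d)) 1) := by
    refine mul_pos hρ (ENNReal.toReal_pos ?_ isBounded_closedBall.measure_lt_top.ne)
    exact (measure_closedBall_pos _ _ one_pos).ne'
  have h2 : Tendsto (fun n : ℕ => (ρ : ℝ) *
      volume.real (closedBall (0 : EuclideanSpace ℝ (Fin d)) 1) * n) atTop atTop :=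
    tendsto_natCast_atTop_atTop.const_mul_atTop h1
  have := ENNReal.tendsto_ofReal (Real.tendsto_exp_neg_atTop_nhds_zero.comp h2)
  rw [ENNReal.ofReal_zero] at this
  exact le_antisymm (ge_of_tendsto' this hle) zero_le

theorem ae_notMem_point [NeZero d] (hL : IsHomogeneousPoisson id L ρ)
    (y : EuclideanSpace ℝ (Fin d)) : ∀ᵐ X : Configuration d ∂L, y ∉ X := by
  have h := hL.lintegral_countMeasure_of_isBounded (measurableSet_singleton y)
    Bornology.isBounded_singleton
  rw [measure_singleton, mul_zero, lintegral_eq_zero_iff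
    (measurable_countMeasure_apply (measurableSet_singleton y))] at h
  filter_upwards [h] with X hX
  exact countMeasure_singleton_eq_zero.1 hX

variable [IsProbabilityMeasure L]

/-- Apply Mecke to the indicator of the event `D` that the difference equals `v`, with no dependence
on the point. Adding `z` shifts the difference by `coulomb (x - z) - coulomb (y - z)`, which takes
any given value only on a null set of `z`. Hence `1_D` times the number of points has zero mean, and
this number is almost surely nonzero. -/
theorem ae_natForce_sub_ne [NeZero d] (hd : 3 ≤ d) (hρ : 0 < ρ) (hL : IsHomogeneousPoisson id L ρ)
    {x y : EuclideanSpace ℝ (Fin d)} (hxy : x ≠ y) (v : EuclideanSpace ℝ (Fin d)) :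
    ∀ᵐ X ∂L, natForce X x - natForce X y ≠ v := by
  have hmx := measurable_natForce_left (d := d)
  let D : Set (Configuration d) := {X | natForce X x - natForce X y = v}
  have hD : MeasurableSet D := measurableSet_eq_fun ((hmx x).sub (hmx y)) measurable_const
  have h := hL.mecke (G := fun X _ => D.indicator 1 X)
    ((measurable_one.indicator hD).comp measurable_fst)
  have h0 : ∫⁻ X, ∫⁻ z, D.indicator 1 (insert z X : Configuration d) ∂volume ∂L = (0 : ℝ≥0∞) := by
    refine (lintegral_congr_ae (g := fun _ => 0) ?_).trans lintegral_zero
    filter_upwards [hL.ae_isValid hd] with X hX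
    refine (lintegral_congr_ae (g := fun _ => 0) ?_).trans lintegral_zero
    have hnull := volume_coulomb_sub_eq_zero hd hxy (v - (natForce X x - natForce X y))
    filter_upwards [ae_notMem X, measure_eq_zero_iff_ae_notMem.1 hnull] with z hz hz2
    refine indicator_of_notMem (fun hzD => hz2 ?_) _
    have hzD' : natForce (insert z X) x - natForce (insert z X) y = v := hzD
    rw [hX.natForce_insert hz, hX.natForce_insert hz] at hzD'
    change coulomb (x - z) - coulomb (y - z) = v - (natForce X x - natForce X y)
    rw [← hzD']
    abel
  rw [h0, mul_zero] at h
  have hm : Measurable fun X : Configuration d => X.countMeasure univ :=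
    measurable_countMeasure_apply MeasurableSet.univ
  simp_rw [lintegral_const] at h
  have hmul : Measurable fun X : Configuration d =>
      D.indicator (1 : Configuration d → ℝ≥0∞) X * X.countMeasure univ :=
    (measurable_one.indicator hD).mul hm
  rw [lintegral_eq_zero_iff hmul] at h
  filter_upwards [h, hL.ae_countMeasure_univ_ne_zero hρ] with X hX hX2 hXv
  have hXD : X ∈ D := hXv
  simp [hXD] at hX
  exact hX2 (by simp [hX])

/-- Second application of Mecke, to the point `y`, with `x` now fixed. After adding `y`, a collision
prescribes the value of `natForce X x - natForce X y`, which `ae_natForce_sub_ne` excludes. -/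
theorem lintegral_collisionsInsert [NeZero d] (hd : 3 ≤ d) (hρ : 0 < ρ)
    (hL : IsHomogeneousPoisson id L ρ) {ε : ℝ} (hε : ε ≠ 0) (x : EuclideanSpace ℝ (Fin d)) :
    ∫⁻ X : Configuration d, X.countMeasure (Prod.mk (X, x) ⁻¹' collisionsInsert ε) ∂L = 0 := by
  let T : Set (Configuration d × EuclideanSpace ℝ (Fin d)) :=
    {p | ((p.1, x), p.2) ∈ collisionsInsert ε}
  have hT : MeasurableSet T :=
    ((measurable_fst.prodMk measurable_const).prodMk measurable_snd)
      (measurableSet_collisionsInsert ε)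
  have h1 := hL.mecke (G := fun X y => T.indicator 1 (X, y)) (measurable_one.indicator hT)
  have h2 (X : Configuration d) : ∫⁻ y, T.indicator 1 (X, y) ∂X.countMeasure =
      X.countMeasure (Prod.mk (X, x) ⁻¹' collisionsInsert ε) := by
    rw [← lintegral_indicator_one (measurable_prodMk_left (measurableSet_collisionsInsert ε))]
    rfl
  have hm : Measurable (Function.uncurry fun (X : Configuration d) (y : EuclideanSpace ℝ (Fin d)) =>
      T.indicator (1 : Configuration d × EuclideanSpace ℝ (Fin d) → ℝ≥0∞) (insert y X, y)) :=
    (measurable_one.indicator hT).comp measurable_addPoint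
  rw [← lintegral_congr h2, h1, lintegral_lintegral_swap hm.aemeasurable]
  refine mul_eq_zero_of_right _ ((lintegral_congr fun y => ?_).trans lintegral_zero)
  refine (lintegral_congr_ae (g := fun _ => 0) ?_).trans lintegral_zero
  by_cases hyx : y = x
  · exact ae_of_all _ fun X => indicator_of_notMem (fun h => h.1 hyx) _
  -- The excluded vector is the solution of the collision equation for the difference of forces,
  -- including the forces that `x` and `y` exert on each other; this divides by `ε`.
  filter_upwards [hL.ae_isValid hd, hL.ae_notMem_point y, hL.ae_natForce_sub_ne hd hρ (Ne.symm hyx)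
    (ε⁻¹ • (y - x) + coulomb (y - x) - coulomb (x - y))] with X hX hyX hXv
  refine indicator_of_notMem (fun h => hXv ?_) _
  have h3 : x + ε • natForce (insert y X) x =
    y + ε • (coulomb (y - x) + natForce (insert y X) y) := h.2
  rw [hX.natForce_insert hyX, hX.natForce_insert hyX, sub_self, coulomb_zero, zero_add,
    smul_add, smul_add] at h3
  refine smul_right_injective _ hε ?_
  change ε • _ = ε • _
  rw [smul_sub, smul_sub, smul_add, smul_inv_smul₀ hε]
  have h4 : ε • natForce X x = y + (ε • coulomb (y - x) + ε • natForce X y) - x -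
      ε • coulomb (x - y) := by
    rw [← h3]; abel
  rw [h4]
  abel

/-- Almost surely, no two points collide. -/
theorem ae_injOn [NeZero d] (hd : 3 ≤ d) (hρ : 0 < ρ) (hL : IsHomogeneousPoisson id L ρ) (ε : ℝ) :
    ∀ᵐ X : Configuration d ∂L, ∀ x ∈ X, ∀ y ∈ X, x ≠ y →
      x + ε • natForce X x ≠ y + ε • natForce X y := by
  rcases eq_or_ne ε 0 with rfl | hε
  · simp
  have hm := measurable_countMeasure_section (measurableSet_collisions (d := d) ε)
  have hm' := measurable_countMeasure_section (measurableSet_collisionsInsert (d := d) ε)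
  have h1 := hL.mecke (G := fun X x => X.countMeasure (Prod.mk (X, x) ⁻¹' collisions ε)) hm
  -- First application of Mecke, to the point `x`. The added point does not collide with itself by
  -- definition, and its own force is unchanged, while that on `y` gains `coulomb (y - x)`.
  have h2 : ∫⁻ X, ∫⁻ x, (insert x X : Configuration d).countMeasure
      (Prod.mk ((insert x X : Configuration d), x) ⁻¹' collisions ε) ∂volume ∂L =
      ∫⁻ X, ∫⁻ x, X.countMeasure (Prod.mk (X, x) ⁻¹' collisionsInsert ε) ∂volume ∂L := by
    refine lintegral_congr_ae ?_
    filter_upwards [hL.ae_isValid hd] with X hX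
    refine lintegral_congr_ae ?_
    filter_upwards [ae_notMem X] with x hx
    rw [countMeasure_insert hx, Measure.add_apply,
      Measure.dirac_apply' _ (measurable_prodMk_left (measurableSet_collisions ε)),
      indicator_of_notMem (fun h => h.1 rfl), zero_add]
    congr 1
    ext y
    simp only [collisions, collisionsInsert, mem_preimage, mem_ofPred_eq]
    rw [hX.natForce_insert hx, hX.natForce_insert hx, sub_self, coulomb_zero, zero_add]
  have h3 : ∫⁻ X : Configuration d, ∫⁻ x, X.countMeasure
      (Prod.mk (X, x) ⁻¹' collisionsInsert ε) ∂volume ∂L = 0 := by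
    rw [lintegral_lintegral_swap hm'.aemeasurable]
    exact (lintegral_congr fun x => hL.lintegral_collisionsInsert hd hρ hε x).trans lintegral_zero
  rw [h2, h3, mul_zero] at h1
  have hmm : Measurable fun X : Configuration d =>
      ∫⁻ x, X.countMeasure (Prod.mk (X, x) ⁻¹' collisions ε) ∂X.countMeasure :=
    Measurable.lintegral_kernel_prod_right' (κ := pointKernel d) hm
  filter_upwards [(lintegral_eq_zero_iff hmm).1 h1] with X hX x hxX y hyX hxy heq
  have h4 := (lintegral_eq_zero_iff (hm.comp (measurable_prodMk_left (x := X)))).1 hX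
  have h5 : X.countMeasure (Prod.mk (X, x) ⁻¹' collisions ε) = 0 := ae_countMeasure_iff.1 h4 x hxX
  exact ae_countMeasure_iff.1 (measure_eq_zero_iff_ae_notMem.1 h5) y hyX ⟨hxy.symm, heq⟩

end IsHomogeneousPoisson

end RepelledPoisson

/-! ### Equivariance, intensity and measurability of the repulsion -/

namespace RepelledPoisson

open Set Metric
open _root_.RepelledPoisson.Configuration

variable {d : ℕ}

namespace Configuration

theorem coe_image (e : EuclideanSpace ℝ (Fin d) ≃ᵢ EuclideanSpace ℝ (Fin d))
    (X : Configuration d) :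
    (X.image e : Set (EuclideanSpace ℝ (Fin d))) = e '' (X : Set (EuclideanSpace ℝ (Fin d))) := rfl

theorem count_image (e : EuclideanSpace ℝ (Fin d) ≃ᵢ EuclideanSpace ℝ (Fin d))
    (X : Configuration d) (B : Set (EuclideanSpace ℝ (Fin d))) :
    (X.image e).count B = X.count (e ⁻¹' B) := by
  rw [count, coe_image, ← image_inter_preimage, e.injective.encard_image, count]

theorem measurable_image (e : EuclideanSpace ℝ (Fin d) ≃ᵢ EuclideanSpace ℝ (Fin d)) :
    Measurable (image e) := by
  refine measurable_of_countMeasure fun B hB _ => ?_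
  have hB' := e.continuous.measurable hB
  simp_rw [countMeasure_apply _ hB, count_image, ← countMeasure_apply _ hB']
  exact measurable_countMeasure_apply hB'

theorem countMeasure_empty : (Configuration.empty : Configuration d).countMeasure = 0 :=
  Measure.restrict_empty

theorem image_empty (e : EuclideanSpace ℝ (Fin d) ≃ᵢ EuclideanSpace ℝ (Fin d)) :
    Configuration.empty.image e = Configuration.empty :=
  SetLike.coe_injective (Set.image_empty e)

end Configuration

theorem IsLocallyFinite.image {S : Set (EuclideanSpace ℝ (Fin d))} (hS : IsLocallyFinite S)
    (e : EuclideanSpace ℝ (Fin d) ≃ᵢ EuclideanSpace ℝ (Fin d)) : IsLocallyFinite (e '' S) :=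
  (Configuration.image e ⟨S, hS⟩).locallyFinite

theorem isLocallyFinite_image_iff {S : Set (EuclideanSpace ℝ (Fin d))}
    (e : EuclideanSpace ℝ (Fin d) ≃ᵢ EuclideanSpace ℝ (Fin d)) :
    IsLocallyFinite (e '' S) ↔ IsLocallyFinite S := by
  refine ⟨fun h => ?_, fun h => h.image e⟩
  have := h.image e.symm
  rwa [image_image, (funext e.symm_apply_apply : (fun x => e.symm (e x)) = id), image_id] at this

section Equivariance

variable {e : EuclideanSpace ℝ (Fin d) ≃ᵢ EuclideanSpace ℝ (Fin d)}
  {r : EuclideanSpace ℝ (Fin d) ≃ₗᵢ[ℝ] EuclideanSpace ℝ (Fin d)}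

/-- The hypothesis says that `e` is an affine isometry with linear part `r`, which treats
translations (`r` the identity) and rotations together. -/
theorem partialForce_image (h : ∀ x z, e x - e z = r (x - z)) (X : Configuration d)
    (x : EuclideanSpace ℝ (Fin d)) (R : ℝ) :
    partialForce (X.image e) (e x) R = r (partialForce X x R) := by
  have hS : (((X.image e : Configuration d) : Set (EuclideanSpace ℝ (Fin d))) \ {e x}) ∩
      closedBall (e x) R =
      e '' (((X : Set (EuclideanSpace ℝ (Fin d))) \ {x}) ∩ closedBall x R) := by
    rw [image_inter e.injective, image_sdiff e.injective, image_singleton, e.image_closedBall,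
      coe_image]
  have hfin : (((X : Set (EuclideanSpace ℝ (Fin d))) \ {x}) ∩ closedBall x R).Finite :=
    (X.finite_inter_of_isBounded isBounded_closedBall).subset
      (inter_subset_inter_left _ sdiff_subset)
  rw [partialForce, hS, finsum_mem_image e.injective.injOn, partialForce]
  refine Eq.trans (finsum_mem_congr rfl fun z _ => ?_)
    ((r : EuclideanSpace ℝ (Fin d) →+ EuclideanSpace ℝ (Fin d)).map_finsum_mem _ hfin).symm
  change _ = r _
  rw [h, r.norm_map, map_smul]

theorem IsValid.image (h : ∀ x z, e x - e z = r (x - z)) {X : Configuration d} (hX : IsValid X) :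
    IsValid (X.image e) := by
  intro y
  obtain ⟨x, rfl⟩ := e.surjective y
  obtain ⟨f, hf⟩ := hX x
  refine ⟨r f, ?_⟩
  simp_rw [funext (partialForce_image h X x)]
  exact (r.continuous.tendsto f).comp hf

theorem image_symm_image (X : Configuration d) : (X.image e).image e.symm = X :=
  SetLike.coe_injective (by
    rw [coe_image, coe_image, image_image,
      (funext e.symm_apply_apply : (fun x => e.symm (e x)) = id), image_id])

theorem isValid_image_iff (h : ∀ x z, e x - e z = r (x - z)) {X : Configuration d} :
    IsValid (X.image e) ↔ IsValid X := by
  refine ⟨fun hX => ?_, fun hX => hX.image h⟩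
  have hs : ∀ x z, e.symm x - e.symm z = r.symm (x - z) := fun x z => by
    rw [LinearIsometryEquiv.eq_symm_apply, ← h, e.apply_symm_apply, e.apply_symm_apply]
  have := hX.image hs
  rwa [image_symm_image] at this

theorem IsValid.force_image (h : ∀ x z, e x - e z = r (x - z)) {X : Configuration d}
    (hX : IsValid X) (x : EuclideanSpace ℝ (Fin d)) :
    force (X.image e) (e x) = r (force X x) := by
  refine Tendsto.limUnder_eq ?_
  simp_rw [funext (partialForce_image h X x)]
  exact (r.continuous.tendsto _).comp (hX.tendsto_force x)

theorem IsValid.repelledSet_image (h : ∀ x z, e x - e z = r (x - z)) {X : Configuration d}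
    (hX : IsValid X) (ε : ℝ) : repelledSet ε (X.image e) = e '' repelledSet ε X := by
  rw [repelledSet, coe_image, repelledSet, image_image, image_image]
  refine image_congr fun x _ => ?_
  have h1 := h (x + ε • force X x) x
  rw [add_sub_cancel_left, map_smul, sub_eq_iff_eq_add'] at h1
  rw [h1, hX.force_image h]

/-- The repulsion operator commutes with the isometries of the space. -/
theorem repulsion_image (h : ∀ x z, e x - e z = r (x - z)) (ε : ℝ) (X : Configuration d) :
    repulsion ε (X.image e) = (repulsion ε X).image e := by
  -- Validity and local finiteness are invariant under `e`, so the exceptional configurations, sent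
  -- to the empty one, correspond on both sides. The identity thus holds without exception.
  by_cases hX : IsValid X
  · have hS := hX.repelledSet_image h ε
    by_cases hl : IsLocallyFinite (repelledSet ε X)
    · rw [repulsion, dif_pos ⟨(isValid_image_iff h).2 hX, hS ▸ hl.image e⟩, repulsion,
        dif_pos ⟨hX, hl⟩]
      exact SetLike.coe_injective hS
    · rw [repulsion, dif_neg (fun hc => hl ((isLocallyFinite_image_iff e).1 (hS ▸ hc.2))),
        repulsion, dif_neg (fun hc => hl hc.2), Configuration.image_empty]
  · rw [repulsion, dif_neg (fun hc => hX ((isValid_image_iff h).1 hc.1)), repulsion,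
      dif_neg (fun hc => hX hc.1), Configuration.image_empty]

theorem addRight_sub_addRight (y x z : EuclideanSpace ℝ (Fin d)) :
    IsometryEquiv.addRight y x - IsometryEquiv.addRight y z =
      LinearIsometryEquiv.refl ℝ (EuclideanSpace ℝ (Fin d)) (x - z) := by
  simp

theorem IsValid.natForce_translate {X : Configuration d} (hX : IsValid X)
    (x : EuclideanSpace ℝ (Fin d)) : natForce (X.translate (-x)) 0 = natForce X x := by
  have h := hX.force_image (addRight_sub_addRight (-x)) x
  rw [IsometryEquiv.addRight_apply, add_neg_cancel] at h
  rw [hX.natForce_eq, Configuration.translate, (hX.image (addRight_sub_addRight (-x))).natForce_eq, h]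
  rfl

end Equivariance

theorem measurable_countMeasure_repelled (ε : ℝ) {B : Set (EuclideanSpace ℝ (Fin d))}
    (hB : MeasurableSet B) :
    Measurable fun X : Configuration d => X.countMeasure {x | x + ε • natForce X x ∈ B} :=
  Kernel.measurable_kernel_prodMk_left (κ := pointKernel d)
    (t := {p : Configuration d × EuclideanSpace ℝ (Fin d) | p.2 + ε • natForce p.1 p.2 ∈ B})
    (measurable_snd.add (measurable_natForce.const_smul ε) hB)

theorem measurableSet_repelled (X : Configuration d) (ε : ℝ) {B : Set (EuclideanSpace ℝ (Fin d))}
    (hB : MeasurableSet B) : MeasurableSet {x | x + ε • natForce X x ∈ B} :=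
  measurable_id.add ((measurable_natForce_right X).const_smul ε) hB

/-- The configurations on which the repulsion operator is injective, with a locally finite
image. -/
structure IsRepellable (ε : ℝ) (X : Configuration d) : Prop where
  isValid : IsValid X
  injOn : InjOn (fun x => x + ε • force X x) X
  isLocallyFinite : IsLocallyFinite (repelledSet ε X)

namespace IsRepellable

variable {ε : ℝ} {X : Configuration d}

theorem coe_repulsion (hX : IsRepellable ε X) :
    (repulsion ε X : Set (EuclideanSpace ℝ (Fin d))) = repelledSet ε X := by
  rw [repulsion, dif_pos ⟨hX.isValid, hX.isLocallyFinite⟩]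
  rfl

theorem countMeasure_repulsion (hX : IsRepellable ε X) {B : Set (EuclideanSpace ℝ (Fin d))}
    (hB : MeasurableSet B) :
    (repulsion ε X).countMeasure B = X.countMeasure {x | x + ε • natForce X x ∈ B} := by
  rw [countMeasure_apply _ hB, countMeasure_apply _ (measurableSet_repelled X ε hB), count,
    hX.coe_repulsion, repelledSet, ← image_inter_preimage,
    (hX.injOn.mono inter_subset_left).encard_image, count]
  simp_rw [hX.isValid.natForce_eq]
  rfl

end IsRepellable

namespace IsHomogeneousPoisson

variable {L : Measure (Configuration d)} {ρ : ℝ≥0} [IsProbabilityMeasure L]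

/-- Counts of the image are counts of preimages, which have the same volumes and remain disjoint; so
the image is again Poisson of intensity `ρ`, and `IsHomogeneousPoisson.ext` applies. -/
theorem map_image (hL : IsHomogeneousPoisson id L ρ)
    {e : EuclideanSpace ℝ (Fin d) ≃ᵢ EuclideanSpace ℝ (Fin d)}
    (he : MeasurePreserving e volume volume) : L.map (Configuration.image e) = L := by
  have h : IsHomogeneousPoisson (Configuration.image e) L ρ :=
    { isPointProcess := (measurable_image e).aemeasurable
      law_count := fun B hB hb => by
        simp_rw [count_image]
        rw [← he.measure_preimage hB.nullMeasurableSet]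
        exact hL.law_count _ (he.measurable hB) (e.isometry.antilipschitz.isBounded_preimage hb)
      indep_count := fun n B hB hd => by
        simp_rw [count_image]
        exact hL.indep_count n _ (fun i => he.measurable (hB i))
          fun i j hij => (hd hij).preimage e }
  exact (hL.ext h.map_id).symm

/-- The mean number of points that the repulsion moves into a set. -/
theorem lintegral_countMeasure_repelled [NeZero d] (hd : 3 ≤ d) (hL : IsHomogeneousPoisson id L ρ)
    (ε : ℝ) {B : Set (EuclideanSpace ℝ (Fin d))} (hB : MeasurableSet B) :
    ∫⁻ X : Configuration d, X.countMeasure {x | x + ε • natForce X x ∈ B} ∂L = ρ * volume B := by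
  let φ : EuclideanSpace ℝ (Fin d) → ℝ≥0∞ := B.indicator 1
  have hφ : Measurable φ := measurable_one.indicator hB
  have hG : Measurable (Function.uncurry fun (X : Configuration d)
      (x : EuclideanSpace ℝ (Fin d)) => φ (x + ε • natForce X x)) :=
    hφ.comp (measurable_snd.add (measurable_natForce.const_smul ε))
  have h1 (X : Configuration d) : ∫⁻ x, φ (x + ε • natForce X x) ∂X.countMeasure =
      X.countMeasure {x | x + ε • natForce X x ∈ B} := by
    rw [← lintegral_indicator_one (measurableSet_repelled X ε hB)]
    rfl
  -- The added point exerts no force on itself.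
  have h2 : ∫⁻ X, ∫⁻ x, φ (x + ε • natForce (insert x X : Configuration d) x) ∂volume ∂L =
      ∫⁻ X, ∫⁻ x, φ (x + ε • natForce X x) ∂volume ∂L := by
    refine lintegral_congr_ae ?_
    filter_upwards [hL.ae_isValid hd] with X hX
    refine lintegral_congr_ae ?_
    filter_upwards [ae_notMem X] with x hx
    rw [hX.natForce_insert hx, sub_self, coulomb_zero, zero_add]
  -- Translating the configuration by `-x`, which preserves `L`, moves the evaluation of the force
  -- from `x` to the origin. The displacement then no longer depends on `x` and disappears in the
  -- Lebesgue integral.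
  have h3 (x : EuclideanSpace ℝ (Fin d)) : ∫⁻ X, φ (x + ε • natForce X x) ∂L =
      ∫⁻ X, φ (x + ε • natForce X 0) ∂L := by
    have hmp : MeasurePreserving (IsometryEquiv.addRight (-x)) volume
        (volume : Measure (EuclideanSpace ℝ (Fin d))) := measurePreserving_add_right volume (-x)
    have hm : Measurable fun X : Configuration d => φ (x + ε • natForce X 0) :=
      hφ.comp (measurable_const.add ((measurable_natForce_left 0).const_smul ε))
    conv_rhs => rw [← hL.map_image hmp, lintegral_map hm (measurable_image _)]
    refine lintegral_congr_ae ?_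
    filter_upwards [hL.ae_isValid hd] with X hX
    rw [← hX.natForce_translate x]
    rfl
  have hG0 : Measurable (Function.uncurry fun (X : Configuration d)
      (x : EuclideanSpace ℝ (Fin d)) => φ (x + ε • natForce X 0)) :=
    hφ.comp (measurable_snd.add
      (((measurable_natForce_left 0).comp measurable_fst).const_smul ε))
  rw [← lintegral_congr h1, hL.mecke (G := fun X x => φ (x + ε • natForce X x)) hG, h2,
    lintegral_lintegral_swap hG.aemeasurable, lintegral_congr h3,
    ← lintegral_lintegral_swap hG0.aemeasurable]
  congr 1
  simp_rw [lintegral_add_right_eq_self φ]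
  rw [lintegral_const, measure_univ, mul_one]
  exact lintegral_indicator_one hB

/-- The mean number of points moved into a ball is finite, so almost surely finitely many points
land in each ball of integer radius. -/
theorem ae_isRepellable [NeZero d] (hd : 3 ≤ d) (hρ : 0 < ρ) (hL : IsHomogeneousPoisson id L ρ)
    (ε : ℝ) : ∀ᵐ X ∂L, IsRepellable ε X := by
  have hfin (n : ℕ) : ∀ᵐ X : Configuration d ∂L,
      X.countMeasure {x | x + ε • natForce X x ∈ closedBall 0 n} < ∞ := by
    refine ae_lt_top (measurable_countMeasure_repelled ε measurableSet_closedBall) ?_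
    rw [hL.lintegral_countMeasure_repelled hd ε measurableSet_closedBall]
    exact ENNReal.mul_ne_top ENNReal.coe_ne_top isBounded_closedBall.measure_lt_top.ne
  filter_upwards [hL.ae_isValid hd, hL.ae_injOn hd hρ ε, ae_all_iff.2 hfin] with X hX hinj hXfin
  simp_rw [hX.natForce_eq] at hinj
  refine ⟨hX, fun x hx y hy hxy => by_contra fun h => hinj x hx y hy h hxy, fun B _ hb => ?_⟩
  obtain ⟨s, hs⟩ := hb.subset_closedBall 0
  obtain ⟨n, hn⟩ := exists_nat_ge s
  have h1 := hXfin n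
  rw [countMeasure_apply _ (measurableSet_repelled X ε measurableSet_closedBall),
    ENat.toENNReal_lt_top, count, encard_lt_top_iff] at h1
  rw [repelledSet, ← image_inter_preimage]
  refine (h1.subset (inter_subset_inter_right _ fun x hx => ?_)).image _
  have h2 := closedBall_subset_closedBall hn (hs hx)
  rwa [mem_ofPred_eq, hX.natForce_eq]

theorem aemeasurable_repulsion [NeZero d] (hd : 3 ≤ d) (hρ : 0 < ρ)
    (hL : IsHomogeneousPoisson id L ρ) (ε : ℝ) : AEMeasurable (repulsion (d := d) ε) L := by
  classical
  have h := hL.ae_isRepellable hd hρ ε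
  -- The set of repellable configurations is not shown to be measurable, so the exceptional set is
  -- enlarged to a measurable null set `N`. Outside `N`, injectivity turns counts of the image into
  -- counts of preimages, which are measurable.
  let N := toMeasurable L {X | ¬ IsRepellable ε X}
  have hN : MeasurableSet N := measurableSet_toMeasurable _ _
  have hN0 : L N = 0 := (measure_toMeasurable _).trans h
  have hNc (X) (hX : X ∉ N) : IsRepellable ε X :=
    by_contra fun hc => hX (subset_toMeasurable _ _ hc)
  refine ⟨fun X => if X ∈ N then Configuration.empty else repulsion ε X,
    measurable_of_countMeasure fun B hB _ => ?_, ?_⟩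
  · convert! (measurable_countMeasure_repelled ε hB).indicator hN.compl using 1
    ext X
    by_cases hX : X ∈ N
    · simp [hX, countMeasure_empty]
    · rw [if_neg hX, indicator_of_mem hX, (hNc X hX).countMeasure_repulsion hB]
  · filter_upwards [measure_eq_zero_iff_ae_notMem.1 hN0] with X hX
    rw [if_neg hX]

theorem identDistrib_image_repulsion [NeZero d] (hd : 3 ≤ d) (hρ : 0 < ρ)
    (hL : IsHomogeneousPoisson id L ρ) (ε : ℝ)
    {e : EuclideanSpace ℝ (Fin d) ≃ᵢ EuclideanSpace ℝ (Fin d)}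
    {r : EuclideanSpace ℝ (Fin d) ≃ₗᵢ[ℝ] EuclideanSpace ℝ (Fin d)}
    (h : ∀ x z, e x - e z = r (x - z)) (he : MeasurePreserving e volume volume) :
    IdentDistrib (fun X => (repulsion ε X).image e) (repulsion ε) L L := by
  have hm := hL.aemeasurable_repulsion hd hρ ε
  refine ⟨(measurable_image e).comp_aemeasurable hm, hm, ?_⟩
  simp_rw [← repulsion_image h]
  have hm' : AEMeasurable (repulsion ε) (L.map (Configuration.image e)) := by rwa [hL.map_image he]
  have := AEMeasurable.map_map_of_aemeasurable hm' (measurable_image e).aemeasurable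
  rw [hL.map_image he] at this
  exact this.symm

end IsHomogeneousPoisson

end RepelledPoisson

/-! ### The theorem, transferred from the law to the probability space -/

open RepelledPoisson in
theorem corollary1 {d : ℕ} (hd : 3 ≤ d) {Ω : Type*} [MeasurableSpace Ω]
    (μ : Measure Ω) [IsProbabilityMeasure μ] (ρ : ℝ≥0) (hρ : 0 < ρ)
    (P : Ω → Configuration d) (hP : IsHomogeneousPoisson P μ ρ) (ε : ℝ) :
    (∀ᵐ ω ∂μ, IsValid (P ω)) ∧
    (∀ᵐ ω ∂μ, ∀ x ∈ P ω, ∀ y ∈ P ω, x ≠ y →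
      x + ε • force (P ω) x ≠ y + ε • force (P ω) y) ∧
    (∀ᵐ ω ∂μ, (repulsion ε (P ω) : Set (EuclideanSpace ℝ (Fin d))) =
      {p | ∃ x ∈ P ω, p = x + ε • force (P ω) x}) ∧
    IsPointProcess (fun ω => repulsion ε (P ω)) μ ∧
    IsStationary (fun ω => repulsion ε (P ω)) μ ∧
    IsIsotropic (fun ω => repulsion ε (P ω)) μ ∧
    HasIntensity (fun ω => repulsion ε (P ω)) μ ρ := by
  have : NeZero d := ⟨by omega⟩
  have hPm : AEMeasurable P μ := hP.isPointProcess
  have hLp : IsProbabilityMeasure (μ.map P) := Measure.isProbabilityMeasure_map hPm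
  have hL := hP.map_id
  have hrep := hL.ae_isRepellable hd hρ ε
  have hg := ae_of_ae_map hPm hrep
  have hm := hL.aemeasurable_repulsion hd hρ ε
  have hident {e : EuclideanSpace ℝ (Fin d) ≃ᵢ EuclideanSpace ℝ (Fin d)}
      {r : EuclideanSpace ℝ (Fin d) ≃ₗᵢ[ℝ] EuclideanSpace ℝ (Fin d)}
      (h : ∀ x z, e x - e z = r (x - z)) (he : MeasurePreserving e volume volume) :
      IdentDistrib (fun ω => (repulsion ε (P ω)).image e) (fun ω => repulsion ε (P ω)) μ μ := by
    have h1 := hL.identDistrib_image_repulsion hd hρ ε h he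
    refine ⟨h1.aemeasurable_fst.comp_aemeasurable hPm, hm.comp_aemeasurable hPm, ?_⟩
    have h2 := AEMeasurable.map_map_of_aemeasurable h1.aemeasurable_fst hPm
    have h3 := AEMeasurable.map_map_of_aemeasurable hm hPm
    exact h2.symm.trans (h1.map_eq.trans h3)
  refine ⟨?_, ?_, ?_, hm.comp_aemeasurable hPm, fun y => ?_, fun r _ => ?_, fun B hB => ?_⟩
  · filter_upwards [hg] with ω h using h.isValid
  · filter_upwards [hg] with ω h x hx y hy hxy heq using hxy (h.injOn hx hy heq)
  · filter_upwards [hg] with ω h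
    rw [h.coe_repulsion]
    ext p
    simp only [repelledSet, Set.mem_image, Set.mem_ofPred_eq, SetLike.mem_coe, eq_comm]
  · exact hident (addRight_sub_addRight y) (measurePreserving_add_right volume y)
  · exact hident (e := r.toIsometryEquiv) (r := r) (fun x z => (map_sub r x z).symm)
      r.measurePreserving
  · have h1 := hL.lintegral_countMeasure_repelled hd ε hB
    rw [lintegral_map' (measurable_countMeasure_repelled ε hB).aemeasurable hPm] at h1
    rw [← h1]
    refine lintegral_congr_ae ?_
    filter_upwards [hg] with ω h
    rw [← h.countMeasure_repulsion hB, Configuration.countMeasure_apply _ hB]
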